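/- For real numbers $0<\lambda<1<\lambda_1<\lambda_2$ put $$\alpha=\lambda+\lambda_1-\lambda_2-\lambda\lambda_1+\lambda\lambda_2+\lambda_1\lambda_2,\qquad a=\sqrt{\frac{\alpha-\sqrt{\alpha^2-4\lambda\lambda_1\lambda_2}}{2}},\qquad b=\sqrt{\frac{\alpha+\sqrt{\alpha^2-4\lambda\lambda_1\lambda_2}}{2}}$$ (these are real, and $\lambda<a<1$, $\lambda_1<b<\lambda_2$). Define $$\varphi_1(t)=\frac{t\big((1-\lambda-\lambda_1+\lambda_2)t^2+\lambda\lambda_1-\lambda\lambda_2-\lambda_1\lambda_2+\lambda\lambda_1\lambda_2\big)}{(t^2-a^2)\sqrt{(t^2-\lambda^2)(t^2-1)(\lambda_1^2-t^2)(\lambda_2^2-t^2)}}\qquad(1<t<\lambda_1),$$ $$\varphi_2(t)=\frac{t^2-b^2}{\sqrt{(t^2-\lambda^2)(t^2-1)(t^2-\lambda_1^2)(\lambda_2^2-t^2)}}\qquad(\lambda_1<t<\lambda_2).$$ **Proposition 3.2.** For every $\lambda\in(0,1)$ there exist real numbers $\lambda_1,\lambda_2$ with $1<\lambda_1<\lambda_2$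 such that $\varphi_1$ is integrable on $(1,\lambda_1)$, $\varphi_2$ is integrable on $(\lambda_1,\lambda_2)$, and simultaneously $$\xi_1=\int_1^{\lambda_1}\varphi_1(t)\,dt=0\qquad\text{and}\qquad \xi_2=\int_{\lambda_1}^{\lambda_2}\varphi_2(t)\,dt=0.$$ -/

import Mathlib

namespace PeriodProblem

noncomputable section

/-- The auxiliary quantity `α = λ + λ₁ - λ₂ - λλ₁ + λλ₂ + λ₁λ₂`
(here `l`, `l₁`, `l₂` stand for `λ`, `λ₁`, `λ₂`). -/
def alpha (l l₁ l₂ : ℝ) : ℝ := l + l₁ - l₂ - l * l₁ + l * l₂ + l₁ * l₂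

/-- The positive number `a` with `a² = (α - √(α² - 4λλ₁λ₂)) / 2`. For `0 < λ < 1 < λ₁ < λ₂` both
radicands are positive. -/
def a (l l₁ l₂ : ℝ) : ℝ :=
  Real.sqrt ((alpha l l₁ l₂ - Real.sqrt (alpha l l₁ l₂ ^ 2 - 4 * l * l₁ * l₂)) / 2)

/-- The positive number `b` with `b² = (α + √(α² - 4λλ₁λ₂)) / 2`. For `0 < λ < 1 < λ₁ < λ₂` both
radicands are positive. -/
def b (l l₁ l₂ : ℝ) : ℝ :=
  Real.sqrt ((alpha l l₁ l₂ + Real.sqrt (alpha l l₁ l₂ ^ 2 - 4 * l * l₁ * l₂)) / 2)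

/-- The density of the real one-form `φ₁` on `(1, λ₁)`. -/
def phi₁ (l l₁ l₂ t : ℝ) : ℝ :=
  t * ((1 - l - l₁ + l₂) * t ^ 2 + l * l₁ - l * l₂ - l₁ * l₂ + l * l₁ * l₂) /
    ((t ^ 2 - a l l₁ l₂ ^ 2) *
      Real.sqrt ((t ^ 2 - l ^ 2) * (t ^ 2 - 1) * (l₁ ^ 2 - t ^ 2) * (l₂ ^ 2 - t ^ 2)))

/-- The density of the real one-form `φ₂` on `(λ₁, λ₂)`. -/
def phi₂ (l l₁ l₂ t : ℝ) : ℝ :=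
  (t ^ 2 - b l l₁ l₂ ^ 2) /
    Real.sqrt ((t ^ 2 - l ^ 2) * (t ^ 2 - 1) * (t ^ 2 - l₁ ^ 2) * (l₂ ^ 2 - t ^ 2))

/-- The period integral `ξ₁(λ₁, λ₂) = ∫₁^{λ₁} φ₁(t)`. -/
def xi₁ (l l₁ l₂ : ℝ) : ℝ := ∫ t in (1 : ℝ)..l₁, phi₁ l l₁ l₂ t

/-- The period integral `ξ₂(λ₁, λ₂) = ∫_{λ₁}^{λ₂} φ₂(t)`. -/
def xi₂ (l l₁ l₂ : ℝ) : ℝ := ∫ t in l₁..l₂, phi₂ l l₁ l₂ t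

end

end PeriodProblem

/-!
Write `x, y` for `λ₁, λ₂`, and `D = y - x`. The substitution `t = √s` with
`s = (p + q)/2 - (q - p)/2 · cos θ`, where `p, q` are the squares of the ends of the interval of
integration, absorbs both endpoint singularities: each period becomes
`∫ θ in 0..π, G (s θ)` with `G` continuous on `[p, q]` (`integral_eq_arcsineIntegral`). This gives
integrability and joint continuity of `ξ₁, ξ₂` in `(x, y)`. For `G s = 1/(s - k)` the integral is
`±π/√((p - k)(q - k))`, so any rational function with simple poles off `[p, q]` has an explicit
integral.

Existence of a common zero is a planar intermediate value theorem (`exists_common_zero`, proved with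
a continuous logarithm of `ξ₁ + i ξ₂`) on the region `x₀ ≤ x ≤ M`, `x + 1 - l ≤ y ≤ 4x/l²`:
* on `y = x + 1 - l`, `ξ₂ > 0` (`Admissible.xi₂_pos_of_sub_eq`);
* on `y = 4x/l²`, `ξ₂ < 0` (`Admissible.xi₂_neg_of_eq`);
* on `x = x₀` close to `1`, at every point `ξ₂ > 0` or `ξ₁ > 0` (`left_edge_sign`): the first holds
  up to `y` slightly larger than `1/l`, the second beyond;
* on `x = M` large, at every point `ξ₂ < 0` or `ξ₁ < 0` (`right_edge_sign`).

The signs come from a Chebyshev-type comparison (`div_sqrt_le`, `le_div_sqrt`). Each `G` is an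
affine function with a single sign change at some `β`, times an algebraic weight `W`. If `W/g` is monotone,
replacing `W` by the multiple of `g` that agrees with `W` at `β` changes `G` in one direction only;
with `g` rational the integral becomes explicit. For `ξ₁` the resulting inequality simplifies
because `A N(A)² = (1 - A)(x² - A)(y² - A)(A - l²)`, where `A = a²` and `N` is the numerator of `φ₁`
(`Admissible.a_sq_mul_numer_sq`).
-/

namespace PeriodProblem

open Set Real MeasureTheory

/-! ### A planar intermediate value theorem -/

theorem lt_iff_lt_of_avoid {h : ℝ → ℝ} (hh : Continuous h) {c : ℝ}
    (hc : ∀ t ∈ Icc (0 : ℝ) 1, h t ≠ c) : h 0 < c ↔ h 1 < c := by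
  constructor
  · intro h0
    by_contra! h1
    obtain ⟨t, ht, he⟩ := intermediate_value_Icc zero_le_one hh.continuousOn ⟨h0.le, h1⟩
    exact hc t ht he
  · intro h1
    by_contra! h0
    obtain ⟨t, ht, he⟩ := intermediate_value_Icc' zero_le_one hh.continuousOn ⟨h1.le, h0⟩
    exact hc t ht he

/-- A version of the Poincaré–Miranda theorem on `[0, 1]²`. A continuous logarithm of the
nonvanishing function `F + i G` would have an argument `θ` in `(0, π)` on the bottom edge, hence
`θ < 0` on the top edge when going up the left edge, but `θ > 0` there when going up the right
edge. -/
theorem exists_common_zero {F G : ℝ × ℝ → ℝ} (hF : Continuous F) (hG : Continuous G)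
    (hbot : ∀ u ∈ Icc (0 : ℝ) 1, 0 < G (u, 0)) (htop : ∀ u ∈ Icc (0 : ℝ) 1, G (u, 1) < 0)
    (hleft : ∀ v ∈ Icc (0 : ℝ) 1, 0 < G (0, v) ∨ 0 < F (0, v))
    (hright : ∀ v ∈ Icc (0 : ℝ) 1, G (1, v) < 0 ∨ F (1, v) < 0) :
    ∃ p, F p = 0 ∧ G p = 0 := by
  by_contra! hne
  set g : ℝ × ℝ → ℂ := fun p => ⟨F p, G p⟩ with hg
  have hgc : Continuous g := by
    have : g = fun p => (F p : ℂ) + G p * Complex.I := by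
      ext p; simp [hg, Complex.mk_eq_add_mul_I]
    rw [this]; fun_prop
  have hsc : IsSimplyConnected (univ : Set (ℝ × ℝ)) := by
    have := convex_univ.contractibleSpace (univ_nonempty (α := ℝ × ℝ))
    exact SimplyConnectedSpace.ofContractible _
  obtain ⟨f, hfc, hf⟩ := Complex.exists_continuousOn_eqOn_exp_comp hsc isOpen_univ
    hgc.continuousOn (by
      rintro ⟨p, -, hp⟩
      have h1 : F p = 0 := congrArg Complex.re hp
      exact hne p h1 (congrArg Complex.im hp))
  rw [continuousOn_univ] at hfc
  -- `θ` is the argument normalised to lie in `[0, 2π)` at the origin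
  obtain ⟨k, hk⟩ : ∃ k : ℤ, k = ⌊(f (0, 0)).im / (2 * π)⌋ := ⟨_, rfl⟩
  set θ : ℝ × ℝ → ℝ := fun p => (f p).im - k * (2 * π) with hθ
  have hθc : Continuous θ := by fun_prop
  have hre : ∀ p, F p = Real.exp (f p).re * cos (θ p) := by
    intro p
    have := congrArg Complex.re (hf (mem_univ p))
    simp only [Function.comp, Complex.exp_re, hg] at this
    rw [← this, hθ]; simp only [Real.cos_sub_int_mul_two_pi]
  have him : ∀ p, G p = Real.exp (f p).re * sin (θ p) := by
    intro p
    have := congrArg Complex.im (hf (mem_univ p))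
    simp only [Function.comp, Complex.exp_im, hg] at this
    rw [← this, hθ]; simp only [Real.sin_sub_int_mul_two_pi]
  have hb : 0 < θ (0, 0) ∧ θ (0, 0) < π := by
    have hpi := Real.two_pi_pos
    have h0 : 0 ≤ θ (0, 0) := by
      have := Int.floor_le ((f (0, 0)).im / (2 * π))
      rw [← hk, le_div_iff₀ hpi] at this
      simp only [hθ]; linarith
    have h1 : θ (0, 0) < 2 * π := by
      have := Int.lt_floor_add_one ((f (0, 0)).im / (2 * π))
      rw [← hk, div_lt_iff₀ hpi] at this
      simp only [hθ]; linarith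
    have hs : 0 < sin (θ (0, 0)) := by
      have := hbot 0 (by simp)
      rw [him] at this
      exact pos_of_mul_pos_right this (Real.exp_pos _).le
    constructor
    · rcases h0.lt_or_eq with h | h
      · exact h
      · rw [← h] at hs; simp at hs
    · by_contra! h
      have : sin (θ (0, 0) - π) ≥ 0 :=
        Real.sin_nonneg_of_nonneg_of_le_pi (by linarith) (by linarith)
      rw [Real.sin_sub_pi] at this
      linarith
  -- along the bottom edge the argument stays in `(0, π)`
  have hbr : 0 < θ (1, 0) := by
    have := (lt_iff_lt_of_avoid (h := fun u => - θ (u, 0)) (c := 0) (by fun_prop) (by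
      intro u hu h
      have := hbot u hu
      rw [him, neg_eq_zero.mp h] at this
      simp at this)).mp (by simpa using hb.1)
    simpa using this
  -- along the left edge it avoids `±π`
  have htl1 : θ (0, 1) < π := by
    refine (lt_iff_lt_of_avoid (h := fun v => θ (0, v)) (c := π) (by fun_prop) ?_).mp hb.2
    intro v hv h
    have := hleft v hv
    rw [him, hre, h] at this
    simp at this
    linarith [Real.exp_pos (f (0, v)).re]
  have htl2 : -π < θ (0, 1) := by
    have := (lt_iff_lt_of_avoid (h := fun v => - θ (0, v)) (c := π) (by fun_prop) (by
      intro v hv h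
      have h' : θ (0, v) = -π := by linarith
      have := hleft v hv
      rw [him, hre, h'] at this
      simp at this
      linarith [Real.exp_pos (f (0, v)).re])).mp (by
        show - θ (0, 0) < π
        linarith [hb.1, Real.pi_pos])
    linarith
  have htl : θ (0, 1) < 0 := by
    by_contra! h
    have h1 := Real.sin_nonneg_of_nonneg_of_le_pi h htl1.le
    have h2 := htop 0 (by simp)
    rw [him] at h2
    exact absurd h2 (not_lt.mpr (mul_nonneg (Real.exp_pos _).le h1))
  -- along the top edge it avoids `0`, and so it does along the right edge
  have htr : θ (1, 1) < 0 := by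
    refine (lt_iff_lt_of_avoid (h := fun u => θ (u, 1)) (c := 0) (by fun_prop) ?_).mp htl
    intro u hu h
    have := htop u hu
    rw [him, h] at this
    simp at this
  have := (lt_iff_lt_of_avoid (h := fun v => θ (1, v)) (c := 0) (by fun_prop) (by
      intro v hv h
      have := hright v hv
      rw [him, hre, h] at this
      simp at this
      linarith [Real.exp_pos (f (1, v)).re])).mpr htr
  linarith

/-! ### Arcsine integrals -/

/-- The integral `∫ s in p..q, G s / √((s - p) (q - s))`, defined by its regular form in the angle
`θ` with `s = (p + q)/2 - (q - p)/2 · cos θ`. -/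
noncomputable def arcsineIntegral (p q : ℝ) (G : ℝ → ℝ) : ℝ :=
  ∫ θ in (0 : ℝ)..π, G ((p + q) / 2 - (q - p) / 2 * cos θ)

theorem arcsine_mem_Icc {p q : ℝ} (h : p ≤ q) (θ : ℝ) :
    (p + q) / 2 - (q - p) / 2 * cos θ ∈ Icc p q := by
  have h1 := cos_le_one θ
  have h2 := neg_one_le_cos θ
  constructor <;> nlinarith

theorem arcsineIntegrable {p q : ℝ} (h : p ≤ q) {G : ℝ → ℝ} (hG : ContinuousOn G (Icc p q)) :
    IntervalIntegrable (fun θ => G ((p + q) / 2 - (q - p) / 2 * cos θ)) volume 0 π :=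
  (hG.comp_continuous (by fun_prop) (arcsine_mem_Icc h)).intervalIntegrable _ _

theorem arcsineIntegral_mono {p q : ℝ} (h : p ≤ q) {G H : ℝ → ℝ} (hG : ContinuousOn G (Icc p q))
    (hH : ContinuousOn H (Icc p q)) (hGH : ∀ s ∈ Icc p q, G s ≤ H s) :
    arcsineIntegral p q G ≤ arcsineIntegral p q H :=
  intervalIntegral.integral_mono_on pi_pos.le (arcsineIntegrable h hG) (arcsineIntegrable h hH)
    fun θ _ => hGH _ (arcsine_mem_Icc h θ)

theorem arcsineIntegral_add {p q : ℝ} (h : p ≤ q) {G H : ℝ → ℝ} (hG : ContinuousOn G (Icc p q))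
    (hH : ContinuousOn H (Icc p q)) :
    arcsineIntegral p q (fun s => G s + H s) = arcsineIntegral p q G + arcsineIntegral p q H :=
  intervalIntegral.integral_add (arcsineIntegrable h hG) (arcsineIntegrable h hH)

theorem arcsineIntegral_const_mul (p q c : ℝ) (G : ℝ → ℝ) :
    arcsineIntegral p q (fun s => c * G s) = c * arcsineIntegral p q G :=
  intervalIntegral.integral_const_mul c _

theorem arcsineIntegral_const (p q c : ℝ) : arcsineIntegral p q (fun _ => c) = c * π := by
  simp [arcsineIntegral, mul_comm]

theorem arcsineIntegral_id (p q : ℝ) : arcsineIntegral p q (fun s => s) = (p + q) / 2 * π := by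
  have : IntervalIntegrable (fun θ => (q - p) / 2 * cos θ) volume 0 π :=
    Continuous.intervalIntegrable (by fun_prop) _ _
  simp only [arcsineIntegral]
  rw [intervalIntegral.integral_sub (by simp) this]
  simp; ring

/-- The antiderivative `(θ + 2 arctan (C sin θ / (A + R - C cos θ))) / R`, `R = √(A² - C²)`, is
smooth on the whole line, unlike the one given by the half-angle substitution. -/
theorem integral_inv_sub_mul_cos {A C : ℝ} (hA : |C| < A) :
    ∫ θ in (0 : ℝ)..π, (A - C * cos θ)⁻¹ = π / √(A ^ 2 - C ^ 2) := by
  have hC := abs_lt.mp hA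
  have hpos : 0 < A ^ 2 - C ^ 2 := by nlinarith
  set R := √(A ^ 2 - C ^ 2) with hR
  have hR0 : 0 < R := sqrt_pos.mpr hpos
  have hR2 : R ^ 2 = A ^ 2 - C ^ 2 := sq_sqrt hpos.le
  have hden : ∀ θ, 0 < A - C * cos θ := by
    intro θ
    have h1 := cos_le_one θ
    have h2 := neg_one_le_cos θ
    rcases le_total 0 C with h | h <;> nlinarith
  have hderiv : ∀ θ : ℝ, HasDerivAt
      (fun θ => (θ + 2 * arctan (C * sin θ / (A + R - C * cos θ))) / R) ((A - C * cos θ)⁻¹) θ := by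
    intro θ
    have hE : 0 < A + R - C * cos θ := by linarith [hden θ]
    have h1 : HasDerivAt (fun θ => C * sin θ / (A + R - C * cos θ))
        ((C * cos θ * (A + R - C * cos θ) - C * sin θ * (C * sin θ)) /
          (A + R - C * cos θ) ^ 2) θ := by
      refine ((hasDerivAt_sin θ).const_mul C).div ?_ hE.ne'
      simpa using ((hasDerivAt_cos θ).const_mul C).const_sub (A + R)
    refine (((hasDerivAt_id θ).add (h1.arctan.const_mul 2)).div_const R).congr_deriv ?_
    have hden' := (hden θ).ne'
    have hsum : (A + R - C * cos θ) ^ 2 + (C * sin θ) ^ 2 ≠ 0 := by positivity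
    have hs : sin θ ^ 2 = 1 - cos θ ^ 2 := by rw [sin_sq]
    have hfact : (A + R - C * cos θ) ^ 2 + (C * sin θ) ^ 2 =
        2 * (A + R) * (A - C * cos θ) := by
      rw [mul_pow, hs]; linear_combination hR2
    have hAR : A + R ≠ 0 := (by linarith [abs_nonneg C] : 0 < A + R).ne'
    have hone : 1 + (C * sin θ / (A + R - C * cos θ)) ^ 2 =
        2 * (A + R) * (A - C * cos θ) / (A + R - C * cos θ) ^ 2 := by
      rw [← hfact]; field_simp
    rw [hone]
    have hE' := hE.ne'
    field_simp
    linear_combination (-C ^ 2) * hs - hR2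
  rw [intervalIntegral.integral_eq_sub_of_hasDerivAt (fun θ _ => hderiv θ)]
  · simp
  · exact (Continuous.inv₀ (by fun_prop) fun θ => (hden θ).ne').intervalIntegrable _ _

theorem arcsineIntegral_inv_sub {p q k : ℝ} (hpq : p ≤ q) (hk : k < p) :
    arcsineIntegral p q (fun s => (s - k)⁻¹) = π / √((p - k) * (q - k)) := by
  have := integral_inv_sub_mul_cos (A := (p + q) / 2 - k) (C := (q - p) / 2)
    (by rw [abs_of_nonneg (by linarith)]; linarith)
  rw [show ((p + q) / 2 - k) ^ 2 - ((q - p) / 2) ^ 2 = (p - k) * (q - k) by ring] at this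
  rw [← this, arcsineIntegral]
  congr 1; ext θ; congr 1; ring

theorem arcsineIntegral_inv_sub' {p q k : ℝ} (hpq : p ≤ q) (hk : q < k) :
    arcsineIntegral p q (fun s => (k - s)⁻¹) = π / √((k - p) * (k - q)) := by
  have := integral_inv_sub_mul_cos (A := k - (p + q) / 2) (C := - ((q - p) / 2))
    (by rw [abs_neg, abs_of_nonneg (by linarith)]; linarith)
  rw [show (k - (p + q) / 2) ^ 2 - (-((q - p) / 2)) ^ 2 = (k - p) * (k - q) by ring] at this
  rw [← this, arcsineIntegral]
  congr 1; ext θ; congr 1; ring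

/-- The substitution `t = √s`, `s = (p² + q²)/2 - (q² - p²)/2 · cos θ`, which removes inverse square
root singularities at both ends. -/
theorem integral_eq_arcsineIntegral {p q : ℝ} (hp : 0 < p) (hpq : p < q) {f G : ℝ → ℝ}
    (hG : ContinuousOn G (Icc (p ^ 2) (q ^ 2)))
    (hf : ∀ t ∈ Ioo p q, f t = 2 * t * G (t ^ 2) / √((t ^ 2 - p ^ 2) * (q ^ 2 - t ^ 2))) :
    IntervalIntegrable f volume p q ∧
      ∫ t in p..q, f t = arcsineIntegral (p ^ 2) (q ^ 2) G := by
  have hpq2 : p ^ 2 < q ^ 2 := by nlinarith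
  set σ : ℝ → ℝ := fun θ => (p ^ 2 + q ^ 2) / 2 - (q ^ 2 - p ^ 2) / 2 * cos θ with hσ
  have hσmem : ∀ θ, σ θ ∈ Icc (p ^ 2) (q ^ 2) := arcsine_mem_Icc hpq2.le
  have hσpos : ∀ θ, 0 < σ θ := fun θ => lt_of_lt_of_le (by positivity) (hσmem θ).1
  set τ : ℝ → ℝ := fun θ => √(σ θ) with hτ
  have hτpos : ∀ θ, 0 < τ θ := fun θ => sqrt_pos.mpr (hσpos θ)
  have hτsq : ∀ θ, τ θ ^ 2 = σ θ := fun θ => sq_sqrt (hσpos θ).le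
  have hderiv : ∀ θ, HasDerivAt τ ((q ^ 2 - p ^ 2) / 2 * sin θ / (2 * τ θ)) θ := by
    intro θ
    have h1 : HasDerivAt σ ((q ^ 2 - p ^ 2) / 2 * sin θ) θ := by
      simpa using ((hasDerivAt_cos θ).const_mul ((q ^ 2 - p ^ 2) / 2)).const_sub _
    exact h1.sqrt (hσpos θ).ne'
  have hmono : StrictMonoOn τ (Icc 0 π) := by
    intro θ h1 θ' h2 h
    have := strictAntiOn_cos h1 h2 h
    exact sqrt_lt_sqrt (hσpos θ).le (by simp only [hσ]; nlinarith)
  have hτ0 : τ 0 = p := by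
    simp only [hτ, hσ, cos_zero]
    rw [show (p ^ 2 + q ^ 2) / 2 - (q ^ 2 - p ^ 2) / 2 * 1 = p ^ 2 by ring, sqrt_sq hp.le]
  have hτπ : τ π = q := by
    simp only [hτ, hσ, cos_pi]
    rw [show (p ^ 2 + q ^ 2) / 2 - (q ^ 2 - p ^ 2) / 2 * (-1) = q ^ 2 by ring,
      sqrt_sq (hp.trans hpq).le]
  have hτc : Continuous τ := continuous_iff_continuousAt.mpr fun θ => (hderiv θ).continuousAt
  have himage : τ '' Ioo 0 π = Ioo p q := by
    apply subset_antisymm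
    · rintro _ ⟨θ, hθ, rfl⟩
      have h0 : (0 : ℝ) ∈ Icc 0 π := ⟨le_rfl, pi_pos.le⟩
      have hπ : π ∈ Icc 0 π := ⟨pi_pos.le, le_rfl⟩
      have hθ' : θ ∈ Icc 0 π := ⟨hθ.1.le, hθ.2.le⟩
      exact ⟨hτ0 ▸ hmono h0 hθ' hθ.1, hτπ ▸ hmono hθ' hπ hθ.2⟩
    · have := intermediate_value_Ioo pi_pos.le hτc.continuousOn
      rwa [hτ0, hτπ] at this
  have hinj : InjOn τ (Ioo 0 π) := (hmono.mono Ioo_subset_Icc_self).injOn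
  have hd : ∀ θ ∈ Ioo 0 π, HasDerivWithinAt τ ((q ^ 2 - p ^ 2) / 2 * sin θ / (2 * τ θ))
      (Ioo 0 π) θ := fun θ _ => (hderiv θ).hasDerivWithinAt
  have hval : EqOn (fun θ => |(q ^ 2 - p ^ 2) / 2 * sin θ / (2 * τ θ)| • f (τ θ))
      (fun θ => G (σ θ)) (Ioo 0 π) := by
    intro θ hθ
    have hs := sin_pos_of_pos_of_lt_pi hθ.1 hθ.2
    have hmem : τ θ ∈ Ioo p q := himage ▸ mem_image_of_mem τ hθ
    have hr : 0 < (q ^ 2 - p ^ 2) / 2 := by linarith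
    have hroot : (σ θ - p ^ 2) * (q ^ 2 - σ θ) = ((q ^ 2 - p ^ 2) / 2 * sin θ) ^ 2 := by
      simp only [hσ]
      rw [mul_pow, sin_sq]; ring
    have hτθ := hτpos θ
    simp only [smul_eq_mul]
    rw [abs_of_pos (by positivity), hf _ hmem, hτsq, hroot, sqrt_sq (by positivity)]
    have : q ^ 2 - p ^ 2 ≠ 0 := by linarith
    field_simp
  have hint : IntegrableOn (fun θ => G (σ θ)) (Ioo 0 π) := by
    have := arcsineIntegrable hpq2.le hG
    rw [intervalIntegrable_iff_integrableOn_Ioo_of_le pi_pos.le] at this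
    exact this
  constructor
  · rw [intervalIntegrable_iff_integrableOn_Ioo_of_le hpq.le, ← himage,
      integrableOn_image_iff_integrableOn_abs_deriv_smul measurableSet_Ioo hd hinj]
    exact hint.congr_fun hval.symm measurableSet_Ioo
  · rw [intervalIntegral.integral_of_le hpq.le, integral_Ioc_eq_integral_Ioo, ← himage,
      integral_image_eq_integral_abs_deriv_smul measurableSet_Ioo hd hinj,
      setIntegral_congr_fun measurableSet_Ioo hval, arcsineIntegral,
      intervalIntegral.integral_of_le pi_pos.le, integral_Ioc_eq_integral_Ioo]

/-! ### The numbers `a²` and `b²` -/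

/-- The parameter range of the two periods; `x` and `y` stand for `λ₁` and `λ₂`. -/
structure Admissible (l x y : ℝ) : Prop where
  l_pos : 0 < l
  l_lt_one : l < 1
  one_lt : 1 < x
  lt : x < y

namespace Admissible

variable {l x y : ℝ} (h : Admissible l x y)
include h

theorem alpha_gt : 1 + l * x * y < alpha l x y := by
  obtain ⟨h0, h1, h2, h3⟩ := h
  have : 0 < (1 - l) * (x - 1) * (1 + y) := by
    apply mul_pos (mul_pos _ _) <;> linarith
  unfold alpha; linarith

theorem prod_pos : 0 < l * x * y := by
  obtain ⟨h0, h1, h2, h3⟩ := h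
  have : 0 < x := by linarith
  have : 0 < y := by linarith
  positivity

theorem disc_pos : 0 < alpha l x y ^ 2 - 4 * l * x * y := by
  have h1 := h.alpha_gt
  have h2 := h.prod_pos
  nlinarith [sq_nonneg (1 - l * x * y)]

theorem a_sq : a l x y ^ 2 = (alpha l x y - √(alpha l x y ^ 2 - 4 * l * x * y)) / 2 := by
  have h1 := h.alpha_gt
  have h2 := h.prod_pos
  refine sq_sqrt ?_
  have : √(alpha l x y ^ 2 - 4 * l * x * y) ≤ alpha l x y :=
    sqrt_le_iff.mpr ⟨by linarith, by linarith⟩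
  linarith

theorem b_sq : b l x y ^ 2 = (alpha l x y + √(alpha l x y ^ 2 - 4 * l * x * y)) / 2 := by
  have h1 := h.alpha_gt
  have h2 := h.prod_pos
  refine sq_sqrt ?_
  have := sqrt_nonneg (alpha l x y ^ 2 - 4 * l * x * y)
  linarith

theorem sum_sq : a l x y ^ 2 + b l x y ^ 2 = alpha l x y := by
  rw [h.a_sq, h.b_sq]; ring

theorem mul_sq : a l x y ^ 2 * b l x y ^ 2 = l * x * y := by
  rw [h.a_sq, h.b_sq]
  linear_combination (-1 / 4 : ℝ) * sq_sqrt h.disc_pos.le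

theorem a_sq_lt_b_sq : a l x y ^ 2 < b l x y ^ 2 := by
  rw [h.a_sq, h.b_sq]
  have := sqrt_pos.mpr h.disc_pos
  linarith

/-- `a²` and `b²` are the roots of `X² - α X + l x y`; they are located by its signs. -/
theorem factor (X : ℝ) : X ^ 2 - alpha l x y * X + l * x * y =
    (X - a l x y ^ 2) * (X - b l x y ^ 2) := by
  rw [← h.sum_sq, ← h.mul_sq]; ring

theorem b_sq_lt {X : ℝ} (hX : a l x y ^ 2 < X) (hp : 0 < X ^ 2 - alpha l x y * X + l * x * y) :
    b l x y ^ 2 < X := by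
  rw [h.factor] at hp
  have := pos_of_mul_pos_right hp (by linarith)
  linarith

theorem between {X : ℝ} (hp : X ^ 2 - alpha l x y * X + l * x * y < 0) :
    a l x y ^ 2 < X ∧ X < b l x y ^ 2 := by
  rw [h.factor] at hp
  have := h.a_sq_lt_b_sq
  constructor
  · by_contra! hX
    nlinarith
  · by_contra! hX
    nlinarith

theorem a_sq_lt_one : a l x y ^ 2 < 1 := (h.between (by linarith [h.alpha_gt])).1

theorem x_sq_lt_b_sq : x ^ 2 < b l x y ^ 2 := by
  refine (h.between ?_).2
  obtain ⟨h0, h1, h2, h3⟩ := h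
  have : 0 < x * (x - 1) * (y - x) * (x + l) := by
    have : 0 < x := by linarith
    have : 0 < x - 1 := by linarith
    have : 0 < y - x := by linarith
    positivity
  unfold alpha; linarith

theorem one_lt_b_sq : 1 < b l x y ^ 2 := by
  have := h.x_sq_lt_b_sq
  have := h.one_lt
  nlinarith

theorem b_sq_lt_y_sq : b l x y ^ 2 < y ^ 2 := by
  have ha := h.a_sq_lt_one
  obtain ⟨h0, h1, h2, h3⟩ := id h
  refine h.b_sq_lt (by nlinarith) ?_
  have : 0 < y * (y - l) * (y - x) * (y + 1) := by
    have : 0 < y := by linarith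
    have : 0 < y - l := by linarith
    have : 0 < y - x := by linarith
    positivity
  unfold alpha; linarith

theorem l_lt_a_sq : l < a l x y ^ 2 := by
  have hb := h.one_lt_b_sq
  obtain ⟨h0, h1, h2, h3⟩ := id h
  have hf := h.factor l
  have : 0 < l * (1 - l) * (y - x) := by
    have : 0 < 1 - l := by linarith
    have : 0 < y - x := by linarith
    positivity
  have : 0 < (l - a l x y ^ 2) * (l - b l x y ^ 2) := by
    rw [← hf]; unfold alpha; linarith
  nlinarith

theorem l_sq_lt : l ^ 2 < l := by nlinarith [h.l_pos, h.l_lt_one]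

end Admissible

/-! ### The periods as arcsine integrals -/

/-- The numerator of `φ₁` in the variable `s = t²`, divided by `t`. -/
noncomputable def numer (l x y s : ℝ) : ℝ :=
  (1 - l - x + y) * s + l * x - l * y - x * y + l * x * y

/-- The regular part of `φ₁` in the variable `s = t²`:
`φ₁ t = 2 t · density₁ (t²) / √((t² - 1) (x² - t²))`. -/
noncomputable def density₁ (l x y s : ℝ) : ℝ :=
  numer l x y s / (s - a l x y ^ 2) / √((s - l ^ 2) * (y ^ 2 - s)) / 2

/-- The regular part of `φ₂` in the variable `s = t²`:
`φ₂ t = 2 t · density₂ (t²) / √((t² - x²) (y² - t²))`. -/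
noncomputable def density₂ (l x y s : ℝ) : ℝ :=
  (s - b l x y ^ 2) / √(s * (s - l ^ 2) * (s - 1)) / 2

namespace Admissible

variable {l x y : ℝ} (h : Admissible l x y)
include h

theorem pos_of_mem₁ {s : ℝ} (hs : s ∈ Icc (1 ^ 2) (x ^ 2)) :
    0 < s - a l x y ^ 2 ∧ 0 < s - l ^ 2 ∧ 0 < y ^ 2 - s := by
  have h1 := h.a_sq_lt_one
  have h2 := h.l_sq_lt
  obtain ⟨h3, h4, h5, h6⟩ := h
  obtain ⟨h7, h8⟩ := hs
  refine ⟨by linarith, by linarith, by nlinarith⟩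

theorem pos_of_mem₂ {s : ℝ} (hs : s ∈ Icc (x ^ 2) (y ^ 2)) :
    0 < s ∧ 0 < s - l ^ 2 ∧ 0 < s - 1 := by
  have h2 := h.l_sq_lt
  obtain ⟨h3, h4, h5, h6⟩ := h
  obtain ⟨h7, h8⟩ := hs
  have : 1 < x ^ 2 := by nlinarith
  refine ⟨by linarith, by linarith, by linarith⟩

theorem continuousOn_density₁ : ContinuousOn (density₁ l x y) (Icc (1 ^ 2) (x ^ 2)) := by
  unfold density₁ numer
  refine ContinuousOn.div_const (ContinuousOn.div (ContinuousOn.div (by fun_prop) (by fun_prop) ?_)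
    (by fun_prop) ?_) _
  · intro s hs; exact (h.pos_of_mem₁ hs).1.ne'
  · intro s hs
    have := h.pos_of_mem₁ hs
    exact (sqrt_pos.mpr (mul_pos this.2.1 this.2.2)).ne'

theorem continuousOn_density₂ : ContinuousOn (density₂ l x y) (Icc (x ^ 2) (y ^ 2)) := by
  unfold density₂
  refine ContinuousOn.div_const (ContinuousOn.div (by fun_prop) (by fun_prop) ?_) _
  intro s hs
  have := h.pos_of_mem₂ hs
  exact (sqrt_pos.mpr (mul_pos (mul_pos this.1 this.2.1) this.2.2)).ne'

theorem xi₁_eq : IntervalIntegrable (phi₁ l x y) volume 1 x ∧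
    xi₁ l x y = arcsineIntegral (1 ^ 2) (x ^ 2) (density₁ l x y) := by
  refine integral_eq_arcsineIntegral one_pos h.one_lt h.continuousOn_density₁ fun t ht => ?_
  have ht0 : 0 < t := by linarith [ht.1]
  have hmem : t ^ 2 ∈ Icc (1 ^ 2) (x ^ 2) :=
    ⟨by gcongr; exact ht.1.le, by gcongr; exact ht.2.le⟩
  obtain ⟨h1, h2, h3⟩ := h.pos_of_mem₁ hmem
  have hs : √((t ^ 2 - l ^ 2) * (t ^ 2 - 1) * (x ^ 2 - t ^ 2) * (y ^ 2 - t ^ 2)) =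
      √((t ^ 2 - l ^ 2) * (y ^ 2 - t ^ 2)) * √((t ^ 2 - 1 ^ 2) * (x ^ 2 - t ^ 2)) := by
    rw [← sqrt_mul (mul_pos h2 h3).le]; congr 1; ring
  have h4 : 0 < (t ^ 2 - 1 ^ 2) * (x ^ 2 - t ^ 2) :=
    mul_pos (by nlinarith [ht.1]) (by nlinarith [ht.2])
  have h5 := (sqrt_pos.mpr h4).ne'
  have h6 := (sqrt_pos.mpr (mul_pos h2 h3)).ne'
  have h7 := h1.ne'
  rw [phi₁, density₁, hs, numer]
  field_simp

theorem xi₂_eq : IntervalIntegrable (phi₂ l x y) volume x y ∧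
    xi₂ l x y = arcsineIntegral (x ^ 2) (y ^ 2) (density₂ l x y) := by
  have hx := h.one_lt
  refine integral_eq_arcsineIntegral (by linarith) h.lt h.continuousOn_density₂ fun t ht => ?_
  have ht0 : 0 < t := by linarith [ht.1]
  have hmem : t ^ 2 ∈ Icc (x ^ 2) (y ^ 2) :=
    ⟨by gcongr; exact ht.1.le, by gcongr; exact ht.2.le⟩
  obtain ⟨h1, h2, h3⟩ := h.pos_of_mem₂ hmem
  have hs : √((t ^ 2 - l ^ 2) * (t ^ 2 - 1) * (t ^ 2 - x ^ 2) * (y ^ 2 - t ^ 2)) =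
      √((t ^ 2 - l ^ 2) * (t ^ 2 - 1)) * √((t ^ 2 - x ^ 2) * (y ^ 2 - t ^ 2)) := by
    rw [← sqrt_mul (mul_pos h2 h3).le]; congr 1; ring
  have hs' : √(t ^ 2 * (t ^ 2 - l ^ 2) * (t ^ 2 - 1)) =
      t * √((t ^ 2 - l ^ 2) * (t ^ 2 - 1)) := by
    rw [mul_assoc, sqrt_mul h1.le, sqrt_sq ht0.le]
  have h4 : 0 < (t ^ 2 - x ^ 2) * (y ^ 2 - t ^ 2) :=
    mul_pos (by nlinarith [ht.1]) (by nlinarith [ht.2])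
  have h5 := (sqrt_pos.mpr h4).ne'
  have h6 := (sqrt_pos.mpr (mul_pos h2 h3)).ne'
  rw [phi₂, density₂, hs, hs']
  field_simp

end Admissible

theorem continuous_xi₁ {X : Type*} [TopologicalSpace X] {l : ℝ} {x y : X → ℝ} (hx : Continuous x)
    (hy : Continuous y) (h : ∀ p, Admissible l (x p) (y p)) :
    Continuous fun p => xi₁ l (x p) (y p) := by
  simp_rw [fun p => (h p).xi₁_eq.2, arcsineIntegral]
  refine intervalIntegral.continuous_parametric_intervalIntegral_of_continuous' ?_ 0 π
  have hmem : ∀ q : X × ℝ, (1 ^ 2 + x q.1 ^ 2) / 2 - (x q.1 ^ 2 - 1 ^ 2) / 2 * cos q.2 ∈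
      Icc (1 ^ 2) (x q.1 ^ 2) := fun q =>
    arcsine_mem_Icc (by nlinarith [(h q.1).one_lt]) _
  simp only [Function.uncurry_def, density₁, numer, a, alpha]
  refine ((Continuous.div (by fun_prop) (by fun_prop) fun q => ?_).div (by fun_prop)
    fun q => ?_).div_const _
  · exact ((h q.1).pos_of_mem₁ (hmem q)).1.ne'
  · have := (h q.1).pos_of_mem₁ (hmem q)
    exact (sqrt_pos.mpr (mul_pos this.2.1 this.2.2)).ne'

theorem continuous_xi₂ {X : Type*} [TopologicalSpace X] {l : ℝ} {x y : X → ℝ} (hx : Continuous x)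
    (hy : Continuous y) (h : ∀ p, Admissible l (x p) (y p)) :
    Continuous fun p => xi₂ l (x p) (y p) := by
  simp_rw [fun p => (h p).xi₂_eq.2, arcsineIntegral]
  refine intervalIntegral.continuous_parametric_intervalIntegral_of_continuous' ?_ 0 π
  have hmem : ∀ q : X × ℝ,
      (x q.1 ^ 2 + y q.1 ^ 2) / 2 - (y q.1 ^ 2 - x q.1 ^ 2) / 2 * cos q.2 ∈
      Icc (x q.1 ^ 2) (y q.1 ^ 2) := fun q =>
    arcsine_mem_Icc (by nlinarith [(h q.1).one_lt, (h q.1).lt]) _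
  simp only [Function.uncurry_def, density₂, b, alpha]
  refine (Continuous.div (by fun_prop) (by fun_prop) fun q => ?_).div_const _
  have := (h q.1).pos_of_mem₂ (hmem q)
  exact (sqrt_pos.mpr (mul_pos (mul_pos this.1 this.2.1) this.2.2)).ne'

/-! ### Comparison with rational functions -/

/-- Chebyshev-type upper bound. Here `w, g` are the values at a point of two positive functions,
`w', g'` their values at a fixed zero of the affine function `d`. If `√w · g` is monotone in the
direction of `d`, then `d / √w` is at most `d · g`, scaled so that the two weights `1 / √w` and `g`
agree at the zero. -/
theorem div_sqrt_le {w w' g g' d : ℝ} (hw : 0 < w) (hw' : 0 < w') (hg : 0 < g) (hg' : 0 < g')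
    (h1 : 0 ≤ d → w' * g' ^ 2 ≤ w * g ^ 2) (h2 : d ≤ 0 → w * g ^ 2 ≤ w' * g' ^ 2) :
    d / √w ≤ (√w' * g')⁻¹ * (d * g) := by
  have hs := sqrt_pos.mpr hw
  have hs' := sqrt_pos.mpr hw'
  have e : √(w * g ^ 2) = √w * g := by rw [sqrt_mul hw.le, sqrt_sq hg.le]
  have e' : √(w' * g' ^ 2) = √w' * g' := by rw [sqrt_mul hw'.le, sqrt_sq hg'.le]
  rw [inv_mul_eq_div, div_le_div_iff₀ hs (by positivity)]
  rcases le_total 0 d with hd | hd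
  · have := sqrt_le_sqrt (h1 hd)
    rw [e, e'] at this
    nlinarith
  · have := sqrt_le_sqrt (h2 hd)
    rw [e, e'] at this
    nlinarith

/-- The lower bound corresponding to `div_sqrt_le`. -/
theorem le_div_sqrt {w w' g g' d : ℝ} (hw : 0 < w) (hw' : 0 < w') (hg : 0 < g) (hg' : 0 < g')
    (h1 : 0 ≤ d → w * g ^ 2 ≤ w' * g' ^ 2) (h2 : d ≤ 0 → w' * g' ^ 2 ≤ w * g ^ 2) :
    (√w' * g')⁻¹ * (d * g) ≤ d / √w := by
  have := div_sqrt_le (d := -d) hw hw' hg hg' (fun h => h2 (by linarith))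
    (fun h => h1 (by linarith))
  rw [neg_div, neg_mul, mul_neg] at this
  linarith

theorem continuousOn_inv_sub {p q k : ℝ} (hk : k < p) :
    ContinuousOn (fun s => (s - k)⁻¹) (Icc p q) :=
  ContinuousOn.inv₀ (by fun_prop) fun s hs => by linarith [hs.1]

theorem arcsineIntegral_partial_fractions {p q k k' : ℝ} (hpq : p ≤ q) (hk : k < p) (hk' : k' < p)
    (A B C : ℝ) :
    arcsineIntegral p q (fun s => A + B * (s - k)⁻¹ + C * (s - k')⁻¹) =
      π * (A + B / √((p - k) * (q - k)) + C / √((p - k') * (q - k'))) := by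
  have c1 := (continuousOn_inv_sub (q := q) hk).const_mul B
  have c2 := (continuousOn_inv_sub (q := q) hk').const_mul C
  have c0 : ContinuousOn (fun s => A + B * (s - k)⁻¹) (Icc p q) := continuousOn_const.add c1
  rw [arcsineIntegral_add hpq c0 c2, arcsineIntegral_add hpq continuousOn_const c1,
    arcsineIntegral_const_mul, arcsineIntegral_const_mul, arcsineIntegral_inv_sub hpq hk,
    arcsineIntegral_inv_sub hpq hk',
    arcsineIntegral_const]
  ring

theorem continuousOn_partial_fractions {p q k k' : ℝ} (hk : k < p) (hk' : k' < p) (A B C : ℝ) :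
    ContinuousOn (fun s => A + B * (s - k)⁻¹ + C * (s - k')⁻¹) (Icc p q) :=
  (continuousOn_const.add ((continuousOn_inv_sub hk).const_mul B)).add
    ((continuousOn_inv_sub hk').const_mul C)

/-! ### Sign criteria for the second period -/

namespace Admissible

variable {l x y : ℝ} (h : Admissible l x y)
include h

theorem x_sq_le_y_sq : x ^ 2 ≤ y ^ 2 := by nlinarith [h.one_lt, h.lt]

theorem one_lt_x_sq : 1 < x ^ 2 := by nlinarith [h.one_lt]

theorem weight_pos {s : ℝ} (hs : s ∈ Icc (x ^ 2) (y ^ 2)) : 0 < s * (s - l ^ 2) * (s - 1) :=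
  have := h.pos_of_mem₂ hs
  mul_pos (mul_pos this.1 this.2.1) this.2.2

theorem b_sq_mem : b l x y ^ 2 ∈ Icc (x ^ 2) (y ^ 2) := ⟨h.x_sq_lt_b_sq.le, h.b_sq_lt_y_sq.le⟩

/-- Comparison with `g = 1/(s(s - 1))`. -/
theorem xi₂_pos_of_lt (hb : x * y * (b l x y ^ 2 - 1) <
    b l x y ^ 2 * √((x ^ 2 - 1) * (y ^ 2 - 1))) : 0 < xi₂ l x y := by
  rw [h.xi₂_eq.2]
  have hx := h.one_lt
  have hy := h.lt
  have hx2 := h.one_lt_x_sq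
  have hxy2 := h.x_sq_le_y_sq
  set β := b l x y ^ 2 with hβ
  have hβm := h.b_sq_mem
  rw [← hβ] at hβm
  obtain ⟨hβ0, hβl, hβ1⟩ := h.pos_of_mem₂ hβm
  set K := (√(β * (β - l ^ 2) * (β - 1)) * (1 / (β * (β - 1))))⁻¹ with hK
  have hKpos : 0 < K := by
    have := sqrt_pos.mpr (h.weight_pos hβm)
    positivity
  have hle := arcsineIntegral_mono hxy2
    (continuousOn_partial_fractions (q := y ^ 2) (k := 0) (k' := 1) (by linarith) hx2 0 (K / 2 * β)
      (-(K / 2 * (β - 1)))) h.continuousOn_density₂ (by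
      intro s hs
      obtain ⟨h1, h2, h3⟩ := h.pos_of_mem₂ hs
      have key : ∀ u v : ℝ, 1 < u → u ≤ v → l ^ 2 < u →
          v * (v - l ^ 2) * (v - 1) * (1 / (v * (v - 1))) ^ 2 ≤
          u * (u - l ^ 2) * (u - 1) * (1 / (u * (u - 1))) ^ 2 := by
        intro u v hu huv hul
        have e : ∀ t : ℝ, 1 < t → t * (t - l ^ 2) * (t - 1) * (1 / (t * (t - 1))) ^ 2 =
            (t - l ^ 2) / (t * (t - 1)) := by
          intro t ht
          have : t ≠ 0 := by linarith
          have : t - 1 ≠ 0 := by linarith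
          field_simp
        rw [e v (by linarith), e u hu, div_le_div_iff₀ (by nlinarith) (by nlinarith)]
        have hl : 0 ≤ 1 - l ^ 2 := by nlinarith [h.l_pos, h.l_lt_one]
        nlinarith [mul_nonneg (sub_nonneg.2 huv)
            (mul_pos (sub_pos.2 hu) (sub_pos.2 (hu.trans_le huv))).le,
          mul_nonneg (sub_nonneg.2 huv) (mul_nonneg hl (sub_pos.2 hu).le),
          mul_nonneg (sub_nonneg.2 huv) (mul_nonneg hl (sub_pos.2 (hu.trans_le huv)).le),
          mul_nonneg (sub_nonneg.2 huv) hl]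
      have := le_div_sqrt (d := s - β) (g := 1 / (s * (s - 1))) (g' := 1 / (β * (β - 1)))
        (h.weight_pos hs) (h.weight_pos hβm) (by positivity) (by positivity)
        (fun hd => key _ _ (by linarith) (by linarith) (by linarith))
        (fun hd => key _ _ (by linarith) (by linarith) (by linarith))
      rw [← hK] at this
      rw [density₂, ← hβ]
      refine le_trans (le_of_eq ?_) (div_le_div_of_nonneg_right this (by norm_num))
      rw [sub_zero]
      field_simp
      ring)
  refine lt_of_lt_of_le ?_ hle
  rw [arcsineIntegral_partial_fractions hxy2 (by linarith) hx2]
  have hQ : 0 < √((x ^ 2 - 1) * (y ^ 2 - 1)) := sqrt_pos.mpr (mul_pos (by linarith) (by linarith))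
  have hP : √((x ^ 2 - 0) * (y ^ 2 - 0)) = x * y := by
    rw [show (x ^ 2 - 0) * (y ^ 2 - 0) = (x * y) ^ 2 by ring, sqrt_sq (by nlinarith)]
  rw [hP]
  have hxy : 0 < x * y := by nlinarith
  refine mul_pos pi_pos ?_
  have : 0 + K / 2 * β / (x * y) + -(K / 2 * (β - 1)) / √((x ^ 2 - 1) * (y ^ 2 - 1)) =
      K / 2 * (β * √((x ^ 2 - 1) * (y ^ 2 - 1)) - x * y * (β - 1)) /
        (x * y * √((x ^ 2 - 1) * (y ^ 2 - 1))) := by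
    have hx0 : x ≠ 0 := by linarith
    have hy0 : y ≠ 0 := by linarith
    field_simp
    ring
  rw [this]
  exact div_pos (mul_pos (by linarith) (by linarith)) (by positivity)

omit h in
/-- On `y - x = 1 - l` the condition of `xi₂_pos_of_lt` reads `b² < P / (P - q)` with `P = x y` and
`q = √((x² - 1)(y² - 1))`, which holds because the polynomial with roots `a²`, `b²` is positive at
`P / (P - q)`. -/
theorem xi₂_pos_of_sub_eq (h : Admissible l x (x + 1 - l)) : 0 < xi₂ l x (x + 1 - l) := by
  apply h.xi₂_pos_of_lt
  have ha := h.a_sq_lt_one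
  obtain ⟨h0, h1, h2, h3⟩ := id h
  obtain ⟨y, hy⟩ : ∃ y, y = x + 1 - l := ⟨_, rfl⟩
  have hyx : y - x = 1 - l := by linarith
  rw [← hy] at h ha ⊢
  set q := √((x ^ 2 - 1) * (y ^ 2 - 1)) with hq
  have hQ : 0 < (x ^ 2 - 1) * (y ^ 2 - 1) := mul_pos (by nlinarith) (by nlinarith)
  have hq0 : 0 < q := sqrt_pos.mpr hQ
  have hq2 : q ^ 2 = (x * y - 1) ^ 2 - (1 - l) ^ 2 := by
    rw [sq_sqrt hQ.le, ← hyx]; ring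
  have hP : 2 - l < x * y := by nlinarith
  have hqP : q < x * y - 1 := by nlinarith
  obtain ⟨P, hPdef⟩ : ∃ P, P = x * y := ⟨_, rfl⟩
  rw [← hPdef] at hq2 hP hqP ⊢
  obtain ⟨z, hz⟩ : ∃ z, z = P - q := ⟨_, rfl⟩
  have hz1 : 1 < z := by linarith
  suffices hlt : b l x y ^ 2 < P / z by
    rw [lt_div_iff₀ (by linarith), hz] at hlt
    linarith
  refine h.b_sq_lt ?_ ?_
  · rw [lt_div_iff₀ (by linarith)]
    nlinarith
  · have hα : alpha l x y = P + l - (1 - l) * (1 - l) := by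
      unfold alpha; rw [hPdef]; linear_combination (-(1 - l)) * hyx
    have e : (P / z) ^ 2 - alpha l x y * (P / z) + l * x * y =
        P * ((1 - z) * (P - l * z) + (1 - l) ^ 2 * z) / z ^ 2 := by
      rw [hα, mul_assoc l, ← hPdef]
      have : z ≠ 0 := by linarith
      field_simp
      ring
    rw [e]
    -- multiplying by the conjugate `P - 1 + q` of `z - 1 = P - 1 - q` removes the square root
    have hw : (z - 1) * (P - 1 + q) = (1 - l) ^ 2 := by
      rw [hz]; linear_combination -hq2
    have key : 0 < l * (P - 2 + l) + (1 - l) * q := by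
      have : 0 < P - 2 + l := by linarith
      have : 0 < 1 - l := by linarith
      positivity
    have : 0 < (P - 1 + q) * ((1 - z) * (P - l * z) + (1 - l) ^ 2 * z) := by
      have e2 : (P - 1 + q) * ((1 - z) * (P - l * z) + (1 - l) ^ 2 * z) =
          (1 - l) ^ 2 * (l * (P - 2 + l) + (1 - l) * q) := by
        have e3 : (P - 1 + q) * ((1 - z) * (P - l * z) + (1 - l) ^ 2 * z) =
          (1 - l) ^ 2 * (z * (P - 1 + q) - (P - l * z)) := by
          linear_combination (-(P - l * z)) * hw
        rw [e3, hz]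
        linear_combination (-(1 - l) ^ 2) * hq2
      rw [e2]
      have : 0 < 1 - l := by linarith
      positivity
    have h4 := pos_of_mul_pos_right this (by linarith)
    exact div_pos (mul_pos (by linarith) h4) (by positivity)

/-- Comparison with `s ^ (-3/2)`. The explicit bound then follows from the tangent-type bounds
`s ^ (-1/2) ≤ (1/κ + κ/s)/2` with `κ² = x y`, and `s ^ (-3/2) ≥ (2/x)(1/s - 1/(s + x²))`, together
with `b² > l x y`. -/
theorem xi₂_neg_of_eq (hy : y = 4 * x / l ^ 2) : xi₂ l x y < 0 := by
  rw [h.xi₂_eq.2]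
  have hl0 := h.l_pos
  have hx := h.one_lt
  have hy' := h.lt
  have hx2 := h.one_lt_x_sq
  have hxy2 := h.x_sq_le_y_sq
  have hAB := h.mul_sq
  have hA := h.a_sq_lt_one
  set β := b l x y ^ 2 with hβ
  have hβm := h.b_sq_mem
  rw [← hβ] at hβm
  obtain ⟨hβ0, hβl, hβ1⟩ := h.pos_of_mem₂ hβm
  have hβP : l * x * y < β := by nlinarith
  set K := (√(β * (β - l ^ 2) * (β - 1)) * (1 / (β * √β)))⁻¹ with hK
  have hKpos : 0 < K := by
    have := sqrt_pos.mpr (h.weight_pos hβm)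
    positivity
  set κ := 2 * x / l with hκ
  have hκ0 : 0 < κ := by positivity
  have hκP : κ ^ 2 = x * y := by rw [hκ, hy]; field_simp; norm_num
  have hle := arcsineIntegral_mono hxy2 h.continuousOn_density₂
    (continuousOn_partial_fractions (q := y ^ 2) (k := 0) (k' := -x ^ 2) (by linarith) (by linarith)
      (K / 2 * (1 / (2 * κ))) (K / 2 * (κ / 2 - 2 * β / x)) (K / 2 * (2 * β / x))) (by
      intro s hs
      obtain ⟨h1, h2, h3⟩ := h.pos_of_mem₂ hs
      have key : ∀ u v : ℝ, 1 < u → u ≤ v → l ^ 2 < u →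
          u * (u - l ^ 2) * (u - 1) * (1 / (u * √u)) ^ 2 ≤
          v * (v - l ^ 2) * (v - 1) * (1 / (v * √v)) ^ 2 := by
        intro u v hu huv hul
        have e : ∀ t : ℝ, 1 < t → t * (t - l ^ 2) * (t - 1) * (1 / (t * √t)) ^ 2 =
            (1 - l ^ 2 / t) * (1 - 1 / t) := by
          intro t ht
          have ht0 : t ≠ 0 := by linarith
          rw [div_pow, mul_pow, sq_sqrt (by linarith)]
          field_simp
        rw [e v (by linarith), e u hu]
        have hu0 : 0 < u := by linarith
        have h5 : l ^ 2 / u < 1 := by rwa [div_lt_one hu0]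
        have h6 : 1 / u < 1 := by rwa [div_lt_one hu0]
        have h7 : l ^ 2 / v ≤ l ^ 2 / u := by gcongr
        have h8 : 1 / v ≤ 1 / u := by gcongr
        exact mul_le_mul (by linarith) (by linarith) (by linarith) (by linarith)
      have := div_sqrt_le (d := s - β) (g := 1 / (s * √s)) (g' := 1 / (β * √β))
        (h.weight_pos hs) (h.weight_pos hβm) (by positivity) (by positivity)
        (fun hd => key _ _ (by linarith) (by linarith) (by linarith))
        (fun hd => key _ _ (by linarith) (by linarith) (by linarith))
      rw [← hK] at this
      rw [density₂, ← hβ, sub_zero, sub_neg_eq_add]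
      refine (div_le_div_of_nonneg_right this (by norm_num)).trans ?_
      set r := √s with hr
      have hr0 : 0 < r := sqrt_pos.mpr h1
      have hrs : s = r ^ 2 := (sq_sqrt h1.le).symm
      rw [hrs]
      have b1 : 1 / r ≤ 1 / (2 * κ) + κ / 2 * (r ^ 2)⁻¹ := by
        have : 1 / (2 * κ) + κ / 2 * (r ^ 2)⁻¹ - 1 / r = (r - κ) ^ 2 / (2 * κ * r ^ 2) := by
          field_simp; ring
        have : 0 ≤ (r - κ) ^ 2 / (2 * κ * r ^ 2) := by positivity
        linarith
      have b2 : 2 / x * (r ^ 2)⁻¹ - 2 / x * (r ^ 2 + x ^ 2)⁻¹ ≤ 1 / (r ^ 2 * r) := by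
        have hx0 : 0 < x := by linarith
        have : 1 / (r ^ 2 * r) - (2 / x * (r ^ 2)⁻¹ - 2 / x * (r ^ 2 + x ^ 2)⁻¹) =
          (r - x) ^ 2 / (r ^ 3 * (r ^ 2 + x ^ 2)) := by
          field_simp; ring
        have : 0 ≤ (r - x) ^ 2 / (r ^ 3 * (r ^ 2 + x ^ 2)) := by positivity
        linarith
      have e1 : (r ^ 2 - β) * (1 / (r ^ 2 * r)) = 1 / r - β * (1 / (r ^ 2 * r)) := by
        field_simp
      have b3 := mul_le_mul_of_nonneg_left b2 hβ0.le
      have b4 : (r ^ 2 - β) * (1 / (r ^ 2 * r)) ≤ 1 / (2 * κ) + (κ / 2 - 2 * β / x) * (r ^ 2)⁻¹ +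
          2 * β / x * (r ^ 2 + x ^ 2)⁻¹ := by
        rw [e1]
        have : β * (2 / x * (r ^ 2)⁻¹ - 2 / x * (r ^ 2 + x ^ 2)⁻¹) =
          2 * β / x * (r ^ 2)⁻¹ - 2 * β / x * (r ^ 2 + x ^ 2)⁻¹ := by ring
        linarith
      have b5 := mul_le_mul_of_nonneg_left b4 (half_pos hKpos).le
      linarith)
  refine lt_of_le_of_lt hle ?_
  rw [arcsineIntegral_partial_fractions hxy2 (by linarith) (by linarith)]
  have hx0 : 0 < x := by linarith
  have hy0 : 0 < y := by linarith
  have hP : √((x ^ 2 - 0) * (y ^ 2 - 0)) = x * y := by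
    rw [show (x ^ 2 - 0) * (y ^ 2 - 0) = (x * y) ^ 2 by ring, sqrt_sq (by positivity)]
  have hR : 7 / 5 * (x * y) ≤ √((x ^ 2 - -x ^ 2) * (y ^ 2 - -x ^ 2)) := by
    apply le_sqrt_of_sq_le
    have : 0 ≤ x ^ 2 * y ^ 2 := by positivity
    have : 0 ≤ x ^ 4 := by positivity
    nlinarith
  rw [hP]
  refine mul_neg_of_pos_of_neg pi_pos ?_
  have hR' : 2 * β / x / √((x ^ 2 - -x ^ 2) * (y ^ 2 - -x ^ 2)) ≤
      2 * β / x / (7 / 5 * (x * y)) := by gcongr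
  have hmain : 1 / (2 * κ) + (κ / 2 - 2 * β / x) / (x * y) + 2 * β / x / (7 / 5 * (x * y)) < 0 := by
    have e : 1 / (2 * κ) + (κ / 2 - 2 * β / x) / (x * y) + 2 * β / x / (7 / 5 * (x * y)) =
        1 / κ - 4 / 7 * (β / (x * y)) / x := by
      have : κ / 2 / (x * y) = 1 / (2 * κ) := by rw [← hκP]; field_simp
      rw [sub_div, this]
      field_simp
      ring
    rw [e]
    have h1 : l < β / (x * y) := by
      rw [lt_div_iff₀ (by positivity)]; linarith
    have h2 : 1 / κ = 1 / 2 * l / x := by rw [hκ]; field_simp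
    rw [h2, sub_neg]
    exact div_lt_div_of_pos_right (by linarith) hx0
  have := mul_neg_of_pos_of_neg (half_pos hKpos) (lt_of_le_of_lt (by linarith) hmain :
    1 / (2 * κ) + (κ / 2 - 2 * β / x) / (x * y) +
      2 * β / x / √((x ^ 2 - -x ^ 2) * (y ^ 2 - -x ^ 2)) < 0)
  refine lt_of_eq_of_lt ?_ this
  ring

/-- Comparison with `g = 1/(s - k)`. The value `k = x²/3` is the largest multiple of `x²` for which
`s³ / (s - k)²` increases on `[x², ∞)`. -/
theorem xi₂_neg_of_le (hD : (4 * x + 6 * (y - x)) * (1 - l) * (y - x + 1) ≤ x * (y - x) ^ 2) :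
    xi₂ l x y < 0 := by
  rw [h.xi₂_eq.2]
  have hl0 := h.l_pos
  have hl1 := h.l_lt_one
  have hx := h.one_lt
  have hy' := h.lt
  have hx2 := h.one_lt_x_sq
  have hxy2 := h.x_sq_le_y_sq
  have hsum := h.sum_sq
  have hA := h.a_sq_lt_one
  set β := b l x y ^ 2 with hβ
  have hβm := h.b_sq_mem
  rw [← hβ] at hβm
  obtain ⟨hβ0, hβl, hβ1⟩ := h.pos_of_mem₂ hβm
  obtain ⟨k, hk⟩ : ∃ k, k = x ^ 2 / 3 := ⟨_, rfl⟩
  have hk3 : x ^ 2 = 3 * k := by linarith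
  have hkx : k < x ^ 2 := by linarith
  set K := (√(β * (β - l ^ 2) * (β - 1)) * (1 / (β - k)))⁻¹ with hK
  have hβk : 0 < β - k := by linarith [hβm.1]
  have hKpos : 0 < K := by
    have := sqrt_pos.mpr (h.weight_pos hβm)
    positivity
  have hle := arcsineIntegral_mono hxy2 h.continuousOn_density₂
    (continuousOn_partial_fractions (q := y ^ 2) (k := k) (k' := k) hkx hkx
      (K / 2) (-(K / 2 * (β - k))) 0) (by
      intro s hs
      obtain ⟨h1, h2, h3⟩ := h.pos_of_mem₂ hs
      have key : ∀ u v : ℝ, x ^ 2 ≤ u → u ≤ v →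
          u * (u - l ^ 2) * (u - 1) * (1 / (u - k)) ^ 2 ≤
          v * (v - l ^ 2) * (v - 1) * (1 / (v - k)) ^ 2 := by
        intro u v hu huv
        have hk0 : 0 < k := by linarith
        have hu0 : 0 < u := by linarith
        have hv0 : 0 < v := by linarith
        have hl : l ^ 2 < 1 := by nlinarith
        have e : ∀ t : ℝ, x ^ 2 ≤ t → t * (t - l ^ 2) * (t - 1) * (1 / (t - k)) ^ 2 =
            (1 - l ^ 2 / t) * (1 - 1 / t) * (t ^ 3 / (t - k) ^ 2) := by
          intro t ht
          have : t ≠ 0 := by linarith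
          have : t - k ≠ 0 := by linarith
          field_simp
        rw [e v (by linarith), e u hu]
        have h5 : l ^ 2 / u < 1 := by rw [div_lt_one hu0]; linarith
        have h6 : 1 / u < 1 := by rw [div_lt_one hu0]; linarith
        have h7 : l ^ 2 / v ≤ l ^ 2 / u := by gcongr
        have h8 : 1 / v ≤ 1 / u := by gcongr
        have h9 : u ^ 3 / (u - k) ^ 2 ≤ v ^ 3 / (v - k) ^ 2 := by
          have huk : 0 < u - k := by linarith
          have hvk : 0 < v - k := by linarith
          rw [div_le_div_iff₀ (by positivity) (by positivity)]
          obtain ⟨i, hi⟩ : ∃ i, i = u - 3 * k := ⟨_, rfl⟩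
          obtain ⟨j, hj⟩ : ∃ j, j = v - u := ⟨_, rfl⟩
          have hi0 : 0 ≤ i := by linarith
          have hj0 : 0 ≤ j := by linarith
          have hue : u = 3 * k + i := by linarith
          have hve : v = 3 * k + i + j := by linarith
          have : 0 ≤ v ^ 3 * (u - k) ^ 2 - u ^ 3 * (v - k) ^ 2 := by
            rw [hue, hve]
            ring_nf
            positivity
          linarith
        have h10 : 0 ≤ u ^ 3 / (u - k) ^ 2 := by positivity
        exact mul_le_mul (mul_le_mul (by linarith) (by linarith) (by linarith) (by linarith)) h9 h10
          (mul_nonneg (by linarith) (by linarith))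
      have hsk : 0 < s - k := by linarith [hs.1]
      have := div_sqrt_le (d := s - β) (g := 1 / (s - k)) (g' := 1 / (β - k))
        (h.weight_pos hs) (h.weight_pos hβm) (by positivity) (by positivity)
        (fun hd => key _ _ hβm.1 (by linarith))
        (fun hd => key _ _ hs.1 (by linarith))
      rw [← hK] at this
      rw [density₂, ← hβ]
      refine (div_le_div_of_nonneg_right this (by norm_num)).trans (le_of_eq ?_)
      field_simp
      ring)
  refine lt_of_le_of_lt hle ?_
  rw [arcsineIntegral_partial_fractions hxy2 hkx hkx]
  refine mul_neg_of_pos_of_neg pi_pos ?_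
  have hpos : 0 < (x ^ 2 - k) * (y ^ 2 - k) := mul_pos (by linarith) (by linarith)
  have hlt : √((x ^ 2 - k) * (y ^ 2 - k)) < β - k := by
    rw [sqrt_lt' hβk]
    obtain ⟨D, hDe⟩ : ∃ D, D = y - x := ⟨_, rfl⟩
    have hye : y = x + D := by linarith
    have hδ : x * y - β < (1 - l) * (D + 1) := by
      have : alpha l x y = x * y + l - (1 - l) * D := by unfold alpha; rw [hDe]; ring
      linarith
    have hPk : 0 < x * y - k := by nlinarith
    have h1 : (x ^ 2 - k) * (y ^ 2 - k) = (x * y - k) ^ 2 - k * D ^ 2 := by rw [hye]; ring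
    have h2 : 2 * (x * y - k) * ((1 - l) * (D + 1)) ≤ k * D ^ 2 := by
      rw [← hDe] at hD
      have := mul_le_mul_of_nonneg_left hD (by linarith : 0 ≤ x / 3)
      rw [hk, hye]
      linarith
    have h3 : (x * y - k) ^ 2 - 2 * (x * y - k) * (x * y - β) ≤ (β - k) ^ 2 := by
      nlinarith [sq_nonneg (x * y - β)]
    have h4 := mul_lt_mul_of_pos_left hδ hPk
    linarith
  have hs := sqrt_pos.mpr hpos
  have : 1 < (β - k) / √((x ^ 2 - k) * (y ^ 2 - k)) := by rwa [one_lt_div hs]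
  have e : K / 2 + -(K / 2 * (β - k)) / √((x ^ 2 - k) * (y ^ 2 - k)) +
      0 / √((x ^ 2 - k) * (y ^ 2 - k)) =
      K / 2 * (1 - (β - k) / √((x ^ 2 - k) * (y ^ 2 - k))) := by
    ring
  rw [e]
  exact mul_neg_of_pos_of_neg (half_pos hKpos) (by linarith)

/-- A bound for `x` close to `1`: split `s - b² = (s - 1) - (b² - 1)`, and use
`(s - 1) ^ (-1/2) ≤ (1/κ + κ/(s - 1))/2` in the second part. -/
theorem xi₂_pos_of_estimate {κ : ℝ} (hκ : 0 < κ)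
    (hest : (b l x y ^ 2 - 1) / (2 * (1 - l)) * (1 / κ + κ / √((x ^ 2 - 1) * (y ^ 2 - 1))) <
      ((x ^ 2 + y ^ 2) / 2 - 1) / y ^ 3) : 0 < xi₂ l x y := by
  rw [h.xi₂_eq.2]
  have hl0 := h.l_pos
  have hl1 := h.l_lt_one
  have hx := h.one_lt
  have hy' := h.lt
  have hx2 := h.one_lt_x_sq
  have hxy2 := h.x_sq_le_y_sq
  have hβ1 := h.one_lt_b_sq
  set β := b l x y ^ 2 with hβ
  set M := (β - 1) / (4 * (1 - l)) with hM
  have h1l : 0 < 1 - l := by linarith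
  have hM0 : 0 < M := div_pos (by linarith) (by linarith)
  have hy0 : 0 < y := by linarith
  have c1 : ContinuousOn (fun s : ℝ => 1 / (2 * y ^ 3) * s) (Icc (x ^ 2) (y ^ 2)) := by fun_prop
  have c2 := continuousOn_partial_fractions (q := y ^ 2) (k := 1) (k' := 1) hx2 hx2
      (-(1 / (2 * y ^ 3)) - M / κ) (- (M * κ)) 0
  have hle := arcsineIntegral_mono hxy2 (c1.add c2) h.continuousOn_density₂ (by
      intro s hs
      obtain ⟨h1, h2, h3⟩ := h.pos_of_mem₂ hs
      have hw := h.weight_pos hs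
      have hsw := sqrt_pos.mpr hw
      have u1 : √(s * (s - l ^ 2) * (s - 1)) ≤ y ^ 3 := by
        rw [sqrt_le_left (by positivity)]
        have e : (y ^ 3) ^ 2 = y ^ 2 * y ^ 2 * y ^ 2 := by ring
        rw [e]
        have := hs.2
        have := sq_nonneg l
        gcongr <;> linarith
      have u2 : (1 - l) * √(s - 1) ≤ √(s * (s - l ^ 2) * (s - 1)) := by
        apply le_sqrt_of_sq_le
        rw [mul_pow, sq_sqrt h3.le]
        have hs1 : 1 ≤ s := by linarith
        gcongr
        nlinarith
      have v1 : (s - 1) / y ^ 3 ≤ (s - 1) / √(s * (s - l ^ 2) * (s - 1)) := by gcongr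
      set r := √(s - 1) with hr
      have hr0 : 0 < r := sqrt_pos.mpr h3
      have hr2 : s - 1 = r ^ 2 := (sq_sqrt h3.le).symm
      have v2 : (β - 1) / √(s * (s - l ^ 2) * (s - 1)) ≤ (β - 1) / ((1 - l) * r) :=
        div_le_div_of_nonneg_left (by linarith) (by positivity) u2
      have v3 : (β - 1) / ((1 - l) * r) ≤ 2 * M / κ + 2 * M * κ * (s - 1)⁻¹ := by
        have : 2 * M / κ + 2 * M * κ * (s - 1)⁻¹ - (β - 1) / ((1 - l) * r) =
            2 * M * ((r - κ) ^ 2 / (κ * r ^ 2)) := by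
          rw [hr2, hM]
          field_simp
          ring
        have : 0 ≤ 2 * M * ((r - κ) ^ 2 / (κ * r ^ 2)) := by positivity
        linarith
      rw [density₂, ← hβ]
      have e : (s - β) / √(s * (s - l ^ 2) * (s - 1)) = (s - 1) / √(s * (s - l ^ 2) * (s - 1)) -
        (β - 1) / √(s * (s - l ^ 2) * (s - 1)) := by ring
      rw [e]
      have e2 : 1 / (2 * y ^ 3) * s + (-(1 / (2 * y ^ 3)) - M / κ + -(M * κ) * (s - 1)⁻¹ +
        0 * (s - 1)⁻¹) = ((s - 1) / y ^ 3 - (2 * M / κ + 2 * M * κ * (s - 1)⁻¹)) / 2 := by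
        ring
      refine le_trans (le_of_eq e2) ?_
      gcongr
      linarith)
  refine lt_of_lt_of_le ?_ hle
  have hadd := arcsineIntegral_add hxy2 c1 c2
  refine lt_of_lt_of_eq ?_ hadd.symm
  rw [arcsineIntegral_partial_fractions hxy2 hx2 hx2, arcsineIntegral_const_mul,
    arcsineIntegral_id]
  have e : 1 / (2 * y ^ 3) * ((x ^ 2 + y ^ 2) / 2 * π) +
      π * (-(1 / (2 * y ^ 3)) - M / κ + -(M * κ) / √((x ^ 2 - 1) * (y ^ 2 - 1)) +
      0 / √((x ^ 2 - 1) * (y ^ 2 - 1))) =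
      π / 2 * (((x ^ 2 + y ^ 2) / 2 - 1) / y ^ 3 -
      (β - 1) / (2 * (1 - l)) * (1 / κ + κ / √((x ^ 2 - 1) * (y ^ 2 - 1)))) := by
    rw [hM]
    field_simp
    ring
  rw [e]
  exact mul_pos (by positivity) (by linarith)

end Admissible

/-! ### Sign criteria for the first period -/

theorem div_sqrt_lt_div_sqrt {m n u v : ℝ} (hn : 0 ≤ n) (hu : 0 < u) (hv : 0 < v)
    (hmn : m ^ 2 * v < n ^ 2 * u) : m / √u < n / √v := by
  rw [div_lt_div_iff₀ (sqrt_pos.mpr hu) (sqrt_pos.mpr hv)]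
  refine lt_of_pow_lt_pow_left₀ 2 (by positivity) ?_
  rwa [mul_pow, mul_pow, sq_sqrt hu.le, sq_sqrt hv.le]

theorem numer_one (l x y : ℝ) : numer l x y 1 = -((1 - l) * (x - 1) * (1 + y)) := by
  unfold numer; ring

theorem numer_l_sq (l x y : ℝ) : numer l x y (l ^ 2) = -((1 - l) * (l + x) * (y - l)) := by
  unfold numer; ring

theorem numer_x_sq (l x y : ℝ) : numer l x y (x ^ 2) = (x - 1) * (x + l) * (y - x) := by
  unfold numer; ring

theorem numer_y_sq (l x y : ℝ) : numer l x y (y ^ 2) = (y + 1) * (y - x) * (y - l) := by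
  unfold numer; ring

namespace Admissible

variable {l x y : ℝ} (h : Admissible l x y)
include h

/-- The numerator of `φ₁` has positive slope, and its zero lies between the ends `1` and `x²`. -/
theorem exists_numer_eq : ∃ c β : ℝ, 0 < c ∧ β ∈ Icc (1 ^ 2) (x ^ 2) ∧
    ∀ s, numer l x y s = c * (s - β) := by
  obtain ⟨h0, h1, h2, h3⟩ := h
  have hc : 0 < 1 - l - x + y := by linarith
  have h4 := numer_one l x y
  have h5 := numer_x_sq l x y
  have h6 : 0 < (1 - l) * (x - 1) * (1 + y) := by
    apply mul_pos (mul_pos _ _) <;> linarith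
  have h7 : 0 < (x - 1) * (x + l) * (y - x) := by
    apply mul_pos (mul_pos _ _) <;> linarith
  have he : ∀ s, numer l x y s = (1 - l - x + y) *
      (s - -(l * x - l * y - x * y + l * x * y) / (1 - l - x + y)) := by
    intro s
    unfold numer
    field_simp
    ring
  refine ⟨_, _, hc, ?_, he⟩
  rw [he] at h4 h5
  constructor
  · by_contra! hlt
    have := mul_pos hc (sub_pos.2 hlt)
    rw [one_pow] at this
    linarith
  · by_contra! hlt
    have := mul_neg_of_pos_of_neg hc (sub_neg.2 hlt)
    linarith

theorem numer_a_sq_neg : numer l x y (a l x y ^ 2) < 0 := by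
  obtain ⟨c, β, hc, hβ, he⟩ := h.exists_numer_eq
  rw [he]
  have := h.a_sq_lt_one
  exact mul_neg_of_pos_of_neg hc (by linarith [hβ.1])

/-- With `p` the polynomial with roots `a²`, `b²` and `N` the numerator,
`p(X)² - X N(X)² = (X - 1)(X - l²)(X - x²)(X - y²)`; this is the case `X = a²`. -/
theorem a_sq_mul_numer_sq : a l x y ^ 2 * numer l x y (a l x y ^ 2) ^ 2 =
    (1 - a l x y ^ 2) * (x ^ 2 - a l x y ^ 2) *
      ((y ^ 2 - a l x y ^ 2) * (a l x y ^ 2 - l ^ 2)) := by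
  have hp := h.factor (a l x y ^ 2)
  rw [sub_self, zero_mul] at hp
  set A := a l x y ^ 2
  unfold numer
  unfold alpha at hp
  linear_combination (A ^ 2 - (l + x - y - l * x + l * y + x * y) * A + l * x * y) * hp

theorem weight₁_pos {s : ℝ} (hs : s ∈ Icc (1 ^ 2) (x ^ 2)) : 0 < (s - l ^ 2) * (y ^ 2 - s) :=
  have := h.pos_of_mem₁ hs
  mul_pos this.2.1 this.2.2

/-- Comparison with `g = 1/(s - l²)`. -/
theorem xi₁_pos (hT : 1 < l * y)
    (hlt : 2 * l * (x - 1) * (y - l) ^ 2 < (l * y - 1) ^ 2 * ((1 + l) * (x - l))) :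
    0 < xi₁ l x y := by
  rw [h.xi₁_eq.2]
  have hl0 := h.l_pos
  have hl1 := h.l_lt_one
  have hx := h.one_lt
  have hy := h.lt
  have hx2 : (1 : ℝ) ^ 2 ≤ x ^ 2 := by nlinarith
  have hA1 := h.a_sq_lt_one
  have hAl := h.l_lt_a_sq
  have hll := h.l_sq_lt
  have hN := h.numer_a_sq_neg
  have hN2 := h.a_sq_mul_numer_sq
  obtain ⟨c, β, hc, hβ, he⟩ := h.exists_numer_eq
  obtain ⟨hβA, hβl, hβy⟩ := h.pos_of_mem₁ hβ
  set A := a l x y ^ 2 with hA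
  have hAl' : 0 < A - l ^ 2 := by linarith
  set K := (√((β - l ^ 2) * (y ^ 2 - β)) * (1 / (β - l ^ 2)))⁻¹ with hK
  have hKpos : 0 < K := by
    have := sqrt_pos.mpr (h.weight₁_pos hβ)
    positivity
  have hle := arcsineIntegral_mono hx2
    (continuousOn_partial_fractions (q := x ^ 2) (k := A) (k' := l ^ 2) (by linarith) (by linarith)
      0 (K / 2 / (A - l ^ 2) * numer l x y A) (-(K / 2 / (A - l ^ 2) * numer l x y (l ^ 2))))
      h.continuousOn_density₁ (by
      intro s hs
      obtain ⟨h1, h2, h3⟩ := h.pos_of_mem₁ hs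
      rw [← hA] at h1
      have key : ∀ u v : ℝ, u ≤ v → v ≤ y ^ 2 → l ^ 2 < u →
          (v - l ^ 2) * (y ^ 2 - v) * (1 / (v - l ^ 2)) ^ 2 ≤
          (u - l ^ 2) * (y ^ 2 - u) * (1 / (u - l ^ 2)) ^ 2 := by
        intro u v huv hv hul
        have e : ∀ t : ℝ, l ^ 2 < t → (t - l ^ 2) * (y ^ 2 - t) * (1 / (t - l ^ 2)) ^ 2 =
            (y ^ 2 - t) / (t - l ^ 2) := by
          intro t ht
          have : t - l ^ 2 ≠ 0 := by linarith
          field_simp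
        rw [e v (by linarith), e u hul]
        apply div_le_div₀ <;> linarith
      have := le_div_sqrt (d := numer l x y s) (g := 1 / (s - l ^ 2)) (g' := 1 / (β - l ^ 2))
        (h.weight₁_pos hs) (h.weight₁_pos hβ) (by positivity) (by positivity)
        (fun hd => by
          rw [he] at hd
          exact key _ _ (by linarith [nonneg_of_mul_nonneg_right hd hc]) (by linarith)
            (by linarith))
        (fun hd => by
          rw [he] at hd
          exact key _ _ (by linarith [nonpos_of_mul_nonpos_right hd hc]) (by linarith)
            (by linarith))
      rw [← hK] at this
      have e : density₁ l x y s =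
          numer l x y s / √((s - l ^ 2) * (y ^ 2 - s)) / (2 * (s - A)) := by
        rw [density₁, ← hA]; field_simp
      rw [e]
      refine le_trans (le_of_eq ?_) (div_le_div_of_nonneg_right this (by linarith))
      unfold numer
      field_simp
      ring)
  refine lt_of_lt_of_le ?_ hle
  rw [arcsineIntegral_partial_fractions hx2 (by linarith) (by linarith)]
  have hU : 0 < (1 ^ 2 - A) * (x ^ 2 - A) := mul_pos (by linarith) (by linarith)
  have hW : 0 < (1 ^ 2 - l ^ 2) * (x ^ 2 - l ^ 2) := mul_pos (by linarith) (by linarith)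
  have hmain : -numer l x y A / √((1 ^ 2 - A) * (x ^ 2 - A)) <
      -numer l x y (l ^ 2) / √((1 ^ 2 - l ^ 2) * (x ^ 2 - l ^ 2)) := by
    have hV : 0 < (1 - l) * (l + x) * (y - l) := by apply mul_pos (mul_pos _ _) <;> linarith
    refine div_sqrt_lt_div_sqrt (by rw [numer_l_sq]; linarith) hU hW ?_
    have hA0 : 0 < A := by linarith
    refine lt_of_mul_lt_mul_left ?_ hA0.le
    have e1 : A * ((-numer l x y A) ^ 2 * ((1 ^ 2 - l ^ 2) * (x ^ 2 - l ^ 2))) =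
        (1 ^ 2 - A) * (x ^ 2 - A) * ((1 - l) * (x + l) *
          ((A * (y - l) ^ 2 - (l * y - A) ^ 2) * ((1 + l) * (x - l)))) := by
      linear_combination (1 - l ^ 2) * (x ^ 2 - l ^ 2) * hN2
    have e2 : A * ((-numer l x y (l ^ 2)) ^ 2 * ((1 ^ 2 - A) * (x ^ 2 - A))) =
        (1 ^ 2 - A) * (x ^ 2 - A) * ((1 - l) * (x + l) *
          (A * (1 - l) * (x + l) * (y - l) ^ 2)) := by
      rw [numer_l_sq]; ring
    rw [e1, e2]
    have hpos : 0 < (1 - l) * (x + l) := mul_pos (by linarith) (by linarith)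
    refine mul_lt_mul_of_pos_left (mul_lt_mul_of_pos_left ?_ hpos) hU
    have k1 : A * (2 * l * (x - 1) * (y - l) ^ 2) ≤ 2 * l * (x - 1) * (y - l) ^ 2 := by
      have : 0 ≤ 2 * l * (x - 1) * (y - l) ^ 2 :=
        mul_nonneg (mul_nonneg (by linarith) (by linarith)) (sq_nonneg _)
      exact mul_le_of_le_one_left this hA1.le
    have k2 : (l * y - 1) ^ 2 * ((1 + l) * (x - l)) ≤ (l * y - A) ^ 2 * ((1 + l) * (x - l)) := by
      have : 0 ≤ (1 + l) * (x - l) := mul_nonneg (by linarith) (by linarith)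
      have : 0 ≤ l * y - 1 := by linarith
      gcongr
    linarith only [k1, k2, hlt]
  have hC : 0 < K / 2 / (A - l ^ 2) := by positivity
  have := mul_pos pi_pos (mul_pos hC (sub_pos.2 hmain))
  refine lt_of_lt_of_eq this ?_
  ring

/-- The inequality to which the comparison in `xi₁_neg` reduces; it follows from
`0 < l y - a² < l y` and `l x < a² y`. -/
theorem a_sq_mul_lt
    (hle : l * y ^ 2 * (y - 1) * (y + x) ≤ 2 * x * (x - 1) * (y - l) ^ 2) :
    a l x y ^ 2 * (y + 1) * (y - x) * (y - l) ^ 2 <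
      (a l x y ^ 2 * (y - l) ^ 2 - (l * y - a l x y ^ 2) ^ 2) * ((y - 1) * (y + x)) := by
  have hAB := h.mul_sq
  have hB1 := h.x_sq_lt_b_sq
  have hB2 := h.b_sq_lt_y_sq
  have hAl := h.l_lt_a_sq
  obtain ⟨hl0, hl1, hx, hy⟩ := id h
  set A := a l x y ^ 2 with hA
  have hA0 : 0 < A := hl0.trans hAl
  have hx0 : 0 < x := by linarith
  have hy0 : 0 < y := by linarith
  have k1 : A * x < l * y := by
    have : A * x ^ 2 < l * x * y := by rw [← hAB]; gcongr
    nlinarith only [this, hx0]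
  have k2 : l * x < A * y := by
    have : l * x * y < A * y ^ 2 := by rw [← hAB]; gcongr
    nlinarith only [this, hy0]
  have k3 : A < l * y := by nlinarith only [k1, hA0, hx]
  have k4 : (l * y - A) ^ 2 < (l * y) ^ 2 := by
    apply pow_lt_pow_left₀ <;> [linarith; linarith; norm_num]
  have k5 : 0 < (y - 1) * (y + x) := mul_pos (by linarith) (by linarith)
  have k6 : 0 < 2 * x * (x - 1) * (y - l) ^ 2 := by
    have : 0 < x - 1 := by linarith
    have : 0 < y - l := by linarith
    positivity
  have k7 := mul_lt_mul_of_pos_right k4 (mul_pos hx0 k5)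
  have k8 := mul_lt_mul_of_pos_right k2 k6
  have k9 := mul_le_mul_of_nonneg_left hle (mul_pos hl0 hx0).le
  have k10 : (l * y - A) ^ 2 * (x * ((y - 1) * (y + x))) <
      A * y * (2 * x * (x - 1) * (y - l) ^ 2) :=
    k7.trans_le ((le_of_eq (by ring)).trans (k9.trans k8.le))
  have e : x * ((A * (y - l) ^ 2 - (l * y - A) ^ 2) * ((y - 1) * (y + x)) -
      A * (y + 1) * (y - x) * (y - l) ^ 2) = A * y * (2 * x * (x - 1) * (y - l) ^ 2) -
      (l * y - A) ^ 2 * (x * ((y - 1) * (y + x))) := by ring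
  have := pos_of_mul_pos_right (e ▸ sub_pos.2 k10) hx0.le
  linarith only [this]

/-- Comparison with `g = 1/(y² - s)`. -/
theorem xi₁_neg (hle' : l * y ^ 2 * (y - 1) * (y + x) ≤ 2 * x * (x - 1) * (y - l) ^ 2) :
    xi₁ l x y < 0 := by
  rw [h.xi₁_eq.2]
  have hl0 := h.l_pos
  have hl1 := h.l_lt_one
  have hx := h.one_lt
  have hy := h.lt
  have hx2 : (1 : ℝ) ^ 2 ≤ x ^ 2 := by nlinarith
  have hxy2 : x ^ 2 < y ^ 2 := by nlinarith
  have hA1 := h.a_sq_lt_one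
  have hAl := h.l_lt_a_sq
  have hll := h.l_sq_lt
  have hN := h.numer_a_sq_neg
  have hN2 := h.a_sq_mul_numer_sq
  obtain ⟨c, β, hc, hβ, he⟩ := h.exists_numer_eq
  obtain ⟨hβA, hβl, hβy⟩ := h.pos_of_mem₁ hβ
  set A := a l x y ^ 2 with hA
  have hA0 : 0 < A := by linarith
  have hyA : 0 < y ^ 2 - A := by linarith
  set K := (√((β - l ^ 2) * (y ^ 2 - β)) * (1 / (y ^ 2 - β)))⁻¹ with hK
  have hKpos : 0 < K := by
    have := sqrt_pos.mpr (h.weight₁_pos hβ)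
    positivity
  have c1 := (continuousOn_inv_sub (q := x ^ 2) (p := 1 ^ 2) (k := A) (by linarith)).const_mul
    (K / 2 / (y ^ 2 - A) * numer l x y A)
  have c2 : ContinuousOn (fun s => K / 2 / (y ^ 2 - A) * numer l x y (y ^ 2) * (y ^ 2 - s)⁻¹)
      (Icc (1 ^ 2) (x ^ 2)) :=
    (ContinuousOn.inv₀ (by fun_prop) fun s hs => by linarith [hs.2]).const_mul _
  have hle := arcsineIntegral_mono hx2 h.continuousOn_density₁ (c1.add c2) (by
      intro s hs
      obtain ⟨h1, h2, h3⟩ := h.pos_of_mem₁ hs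
      rw [← hA] at h1
      have key : ∀ u v : ℝ, u ≤ v → v < y ^ 2 → l ^ 2 < u →
          (u - l ^ 2) * (y ^ 2 - u) * (1 / (y ^ 2 - u)) ^ 2 ≤
          (v - l ^ 2) * (y ^ 2 - v) * (1 / (y ^ 2 - v)) ^ 2 := by
        intro u v huv hv hul
        have e : ∀ t : ℝ, t < y ^ 2 → (t - l ^ 2) * (y ^ 2 - t) * (1 / (y ^ 2 - t)) ^ 2 =
            (t - l ^ 2) / (y ^ 2 - t) := by
          intro t ht
          have : y ^ 2 - t ≠ 0 := by linarith
          field_simp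
        rw [e v (by linarith), e u (by linarith)]
        apply div_le_div₀ <;> linarith
      have := div_sqrt_le (d := numer l x y s) (g := 1 / (y ^ 2 - s)) (g' := 1 / (y ^ 2 - β))
        (h.weight₁_pos hs) (h.weight₁_pos hβ) (by positivity) (by positivity)
        (fun hd => by
          rw [he] at hd
          exact key _ _ (by linarith [nonneg_of_mul_nonneg_right hd hc]) (by linarith)
            (by linarith))
        (fun hd => by
          rw [he] at hd
          exact key _ _ (by linarith [nonpos_of_mul_nonpos_right hd hc]) (by linarith)
            (by linarith))
      rw [← hK] at this
      have e : density₁ l x y s =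
          numer l x y s / √((s - l ^ 2) * (y ^ 2 - s)) / (2 * (s - A)) := by
        rw [density₁, ← hA]; field_simp
      rw [e]
      refine (div_le_div_of_nonneg_right this (by linarith)).trans (le_of_eq ?_)
      simp only [Pi.add_apply]
      unfold numer
      field_simp
      ring)
  refine lt_of_le_of_lt hle ?_
  refine lt_of_eq_of_lt (arcsineIntegral_add hx2 c1 c2) ?_
  rw [arcsineIntegral_const_mul, arcsineIntegral_const_mul,
    arcsineIntegral_inv_sub hx2 (by linarith), arcsineIntegral_inv_sub' hx2 (by linarith)]
  have hU : 0 < (1 ^ 2 - A) * (x ^ 2 - A) := mul_pos (by linarith) (by linarith)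
  have hW : 0 < (y ^ 2 - 1 ^ 2) * (y ^ 2 - x ^ 2) := mul_pos (by linarith) (by linarith)
  have hmain : numer l x y (y ^ 2) / √((y ^ 2 - 1 ^ 2) * (y ^ 2 - x ^ 2)) <
      -numer l x y A / √((1 ^ 2 - A) * (x ^ 2 - A)) := by
    refine div_sqrt_lt_div_sqrt (by linarith) hW hU ?_
    refine lt_of_mul_lt_mul_left ?_ hA0.le
    have e1 : A * ((-numer l x y A) ^ 2 * ((y ^ 2 - 1 ^ 2) * (y ^ 2 - x ^ 2))) =
        (1 ^ 2 - A) * (x ^ 2 - A) * ((y + 1) * (y - x) *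
          ((A * (y - l) ^ 2 - (l * y - A) ^ 2) * ((y - 1) * (y + x)))) := by
      linear_combination (y ^ 2 - 1) * (y ^ 2 - x ^ 2) * hN2
    have e2 : A * (numer l x y (y ^ 2) ^ 2 * ((1 ^ 2 - A) * (x ^ 2 - A))) =
        (1 ^ 2 - A) * (x ^ 2 - A) * ((y + 1) * (y - x) *
          (A * (y + 1) * (y - x) * (y - l) ^ 2)) := by
      rw [numer_y_sq]; ring
    rw [e1, e2]
    have hpos : 0 < (y + 1) * (y - x) := mul_pos (by linarith) (by linarith)
    refine mul_lt_mul_of_pos_left (mul_lt_mul_of_pos_left ?_ hpos) hU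
    have := h.a_sq_mul_lt hle'
    rw [← hA] at this
    linarith
  have hC : 0 < K / 2 / (y ^ 2 - A) := by positivity
  have := mul_neg_of_pos_of_neg pi_pos (mul_neg_of_pos_of_neg hC (sub_neg.2 hmain))
  refine lt_of_eq_of_lt ?_ this
  ring

end Admissible

/-! ### Signs on the boundary of the region -/

/-- For `x - 1` of order `τ²` and `l y ≤ 1 + τ`, the number `b² - 1` is at most of order `τ`. -/
theorem Admissible.b_sq_lt_one_add {l x y τ : ℝ} (h : Admissible l x y) (hτ0 : 0 < τ)
    (hτ1 : τ ≤ 1) (hx : x = 1 + l * (1 - l ^ 2) / 16 * τ ^ 2) (hy : l * y ≤ 1 + τ) :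
    b l x y ^ 2 < 1 + 2 * τ := by
  have hA := h.a_sq_lt_one
  obtain ⟨hl0, hl1, hx1, hxy⟩ := id h
  obtain ⟨ε, hε⟩ : ∃ ε, ε = x - 1 := ⟨_, rfl⟩
  have hετ : ε = l * (1 - l ^ 2) / 16 * τ ^ 2 := by linarith
  have hxε : x = 1 + ε := by linarith
  have hε0 : 0 < ε := by linarith
  refine h.b_sq_lt (by linarith) ?_
  have e : (1 + 2 * τ) ^ 2 - alpha l x y * (1 + 2 * τ) + l * x * y =
      (2 * τ) ^ 2 - (ε * (1 + y - l) + (l * y - 1)) * (2 * τ) - (1 - l) * ε * (1 + y) := by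
    unfold alpha; rw [hxε]; ring
  rw [e]
  have hl2 : 0 ≤ 1 - l ^ 2 := by nlinarith only [hl0, hl1]
  have h1 : ε * (1 + y) ≤ 3 / 16 * τ ^ 2 := by
    rw [hετ]
    have : l * (1 + y) * (1 - l ^ 2) ≤ 3 * 1 :=
      mul_le_mul (by linarith) (by linarith [sq_nonneg l]) hl2 (by norm_num)
    have := mul_le_mul_of_nonneg_left this (by positivity : 0 ≤ τ ^ 2 / 16)
    linarith
  have h2 : (ε * (1 + y - l) + (l * y - 1)) * (2 * τ) ≤ (3 / 16 * τ ^ 2 + τ) * (2 * τ) := by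
    have : 0 < ε * l := by positivity
    exact mul_le_mul_of_nonneg_right (by linarith) (by linarith)
  have h3 : (1 - l) * ε * (1 + y) ≤ 3 / 16 * τ ^ 2 := by
    have : 0 < y := by linarith
    have : 0 < l * (ε * (1 + y)) := by positivity
    linarith
  have h4 : τ ^ 3 ≤ τ ^ 2 := pow_le_pow_of_le_one hτ0.le hτ1 (by norm_num)
  have : 0 < τ ^ 2 := by positivity
  linarith

theorem Admissible.xi₁_pos_of_one_add_lt {l x y τ : ℝ} (h : Admissible l x y) (hτ0 : 0 < τ)
    (hτ1 : τ ≤ 1) (hx : x = 1 + l * (1 - l ^ 2) / 16 * τ ^ 2) (hcase : 1 + τ < l * y) :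
    0 < xi₁ l x y := by
  obtain ⟨hl0, hl1, hx1, hxy⟩ := id h
  have hl2 : 0 < 1 - l ^ 2 := by nlinarith only [hl0, hl1]
  have hy0 : 0 < y := by linarith
  refine h.xi₁_pos (by linarith) ?_
  have h1 : l * y * (τ / 2) ≤ l * y - 1 := by
    linarith [mul_nonneg (sub_nonneg.2 hcase.le) (by linarith : 0 ≤ 1 - τ / 2),
      mul_nonneg hτ0.le (sub_nonneg.2 hτ1)]
  have h2 : (l * y * (τ / 2)) ^ 2 ≤ (l * y - 1) ^ 2 := by gcongr
  have h3 : 1 - l ^ 2 ≤ (1 + l) * (x - l) := by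
    linarith only [mul_nonneg (by linarith : 0 ≤ 1 + l) (by linarith : 0 ≤ x - 1)]
  have h4 : (y - l) ^ 2 ≤ y ^ 2 := by
    apply pow_le_pow_left₀ <;> linarith
  calc 2 * l * (x - 1) * (y - l) ^ 2 ≤ 2 * l * (x - 1) * y ^ 2 := by
        have : 0 < x - 1 := by linarith
        gcongr
    _ = (l * y * (τ / 2)) ^ 2 * (1 - l ^ 2) / 2 := by rw [hx]; ring
    _ < (l * y * (τ / 2)) ^ 2 * (1 - l ^ 2) := half_lt_self (by positivity)
    _ ≤ (l * y - 1) ^ 2 * ((1 + l) * (x - l)) := by gcongr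

theorem Admissible.xi₂_pos_of_le_one_add {l κ x y : ℝ} (h : Admissible l x y)
    (hκ : κ = (1 - l) ^ 3 * l ^ 3 / 24) (hκ0 : 0 < κ) (hκ1 : κ ≤ 1)
    (hx : x = 1 + l * (1 - l ^ 2) / 16 * κ ^ 4) (hy : x + 1 - l ≤ y)
    (hcase : l * y ≤ 1 + κ ^ 2) : 0 < xi₂ l x y := by
  have hB1 := h.one_lt_b_sq
  obtain ⟨hl0, hl1, hx1, hxy⟩ := id h
  have h1l : 0 < 1 - l := by linarith
  obtain ⟨τ, hτ⟩ : ∃ τ, τ = κ ^ 2 := ⟨_, rfl⟩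
  have hτ0 : 0 < τ := by rw [hτ]; positivity
  have hτ1 : τ ≤ 1 := by rw [hτ]; exact pow_le_one₀ hκ0.le hκ1
  rw [← hτ] at hcase
  obtain ⟨ε, hε⟩ : ∃ ε, ε = x - 1 := ⟨_, rfl⟩
  have hετ : ε = l * (1 - l ^ 2) / 16 * τ ^ 2 := by rw [hε, hx, hτ]; ring
  have hxε : x = 1 + ε := by linarith
  have hε0 : 0 < ε := by linarith
  have hy0 : 0 < y := by linarith
  have hly : l * y ≤ 2 := by linarith
  have hB := h.b_sq_lt_one_add hτ0 hτ1 (by rw [hx, hτ]; ring) hcase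
  refine h.xi₂_pos_of_estimate hκ0 ?_
  have hq : l * (1 - l) / 2 * κ ^ 2 ≤ √((x ^ 2 - 1) * (y ^ 2 - 1)) := by
    apply le_sqrt_of_sq_le
    have h1 : 2 * ε ≤ x ^ 2 - 1 := by rw [hxε]; linarith [sq_nonneg ε]
    have h2 : 2 * (1 - l) ≤ y ^ 2 - 1 := by nlinarith only [hy, hx1, hl1]
    have h3 : 2 * ε * (2 * (1 - l)) ≤ (x ^ 2 - 1) * (y ^ 2 - 1) := by gcongr; linarith
    refine le_trans ?_ h3
    rw [hετ, ← hτ]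
    have : 0 ≤ l * (1 - l) ^ 2 * τ ^ 2 / 4 := by positivity
    nlinarith
  have hrhs : (1 - l) * l ^ 2 / 8 ≤ ((x ^ 2 + y ^ 2) / 2 - 1) / y ^ 3 := by
    rw [le_div_iff₀ (by positivity)]
    have h1 : (l * y) ^ 2 ≤ 4 := by
      have : 0 ≤ l * y := by positivity
      nlinarith
    have h2 : (1 - l) * l ^ 2 / 8 * y ^ 3 ≤ (1 - l) * y / 2 := by
      have := mul_le_mul_of_nonneg_left h1 (by positivity : 0 ≤ (1 - l) * y / 8)
      linarith
    nlinarith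
  refine lt_of_lt_of_le ?_ hrhs
  have hm : 0 < l * (1 - l) := by positivity
  have h1 : 1 / κ + κ / √((x ^ 2 - 1) * (y ^ 2 - 1)) ≤
      1 / κ + κ / (l * (1 - l) / 2 * κ ^ 2) := by gcongr
  have h2 : 1 / κ + κ / (l * (1 - l) / 2 * κ ^ 2) = (l * (1 - l) + 2) / (l * (1 - l) * κ) := by
    field_simp
  have h3 : (l * (1 - l) + 2) / (l * (1 - l) * κ) < 3 / (l * (1 - l) * κ) := by
    have : l * (1 - l) < 1 := by nlinarith
    gcongr
    linarith
  have h4 : (b l x y ^ 2 - 1) / (2 * (1 - l)) ≤ κ ^ 2 / (1 - l) := by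
    rw [div_le_div_iff₀ (by positivity) h1l, ← hτ]
    nlinarith
  calc _ ≤ κ ^ 2 / (1 - l) * (1 / κ + κ / √((x ^ 2 - 1) * (y ^ 2 - 1))) := by gcongr
    _ < κ ^ 2 / (1 - l) * (3 / (l * (1 - l) * κ)) :=
        mul_lt_mul_of_pos_left (by linarith) (by positivity)
    _ = (1 - l) * l ^ 2 / 8 := by
        have : κ ^ 2 / (1 - l) * (3 / (l * (1 - l) * κ)) = 3 * κ / (l * (1 - l) ^ 2) := by
          field_simp
        rw [this, hκ]
        field_simp
        norm_num

/-- With `x - 1` of order `κ⁴`, the period `ξ₂` is positive for `l y ≤ 1 + κ²` and `ξ₁` is positive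
for `l y > 1 + κ²`. At `l y = 1 + κ²` both `κ²` and `b² - 1` are much larger than `x - 1`, but small
enough for the logarithmic divergence of `ξ₂` as `x → 1` not to matter. -/
theorem left_edge_sign {l κ x y : ℝ} (h : Admissible l x y)
    (hκ : κ = (1 - l) ^ 3 * l ^ 3 / 24) (hx : x = 1 + l * (1 - l ^ 2) / 16 * κ ^ 4)
    (hy : x + 1 - l ≤ y) : 0 < xi₂ l x y ∨ 0 < xi₁ l x y := by
  obtain ⟨hl0, hl1, hx1, hxy⟩ := id h
  have h1l : 0 < 1 - l := by linarith
  have hκ0 : 0 < κ := by rw [hκ]; positivity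
  have hκ1 : κ ≤ 1 := by
    have h1 : (1 - l) ^ 3 ≤ 1 := pow_le_one₀ h1l.le (by linarith)
    have h2 : l ^ 3 ≤ 1 := pow_le_one₀ hl0.le hl1.le
    have h3 : (1 - l) ^ 3 * l ^ 3 ≤ 1 := mul_le_one₀ h1 (by positivity) h2
    rw [hκ]; linarith
  rcases le_or_gt (l * y) (1 + κ ^ 2) with hcase | hcase
  · exact Or.inl (h.xi₂_pos_of_le_one_add hκ hκ0 hκ1 hx hy hcase)
  · exact Or.inr (h.xi₁_pos_of_one_add_lt (by positivity) (pow_le_one₀ hκ0.le hκ1)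
      (by rw [hx]; ring) hcase)

/-- For large `x`, `ξ₁` is negative when `y/x` is close to `1`, and `ξ₂` is negative otherwise. The
threshold `(3 - l)/2` is a ratio `r > 1` with `l r (r + 1) < 2`. -/
theorem right_edge_sign {l x y : ℝ} (h : Admissible l x y) (hx : 28 / (1 - l) ≤ x) :
    xi₂ l x y < 0 ∨ xi₁ l x y < 0 := by
  obtain ⟨hl0, hl1, hx1, hxy⟩ := id h
  have h1l : 0 < 1 - l := by linarith
  rw [div_le_iff₀ h1l] at hx
  have hx28 : 28 ≤ x := by nlinarith
  rcases le_or_gt y ((3 - l) / 2 * x) with hcase | hcase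
  · right
    apply h.xi₁_neg
    have h1 : l * y * (y + x) ≤ 2 * (x - 1) ^ 2 := by
      have k1 : l * y * (y + x) ≤ l * ((3 - l) / 2 * x) * ((3 - l) / 2 * x + x) := by
        have : 0 < y := by linarith
        have : 0 < 3 - l := by linarith
        gcongr
      have k2 : l * ((3 - l) / 2 * x) * ((3 - l) / 2 * x + x) =
          2 * x ^ 2 - (1 - l) * (8 - 7 * l + l ^ 2) / 4 * x ^ 2 := by ring
      have k3 : (1 - l) / 2 * x ^ 2 ≤ (1 - l) * (8 - 7 * l + l ^ 2) / 4 * x ^ 2 := by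
        have : 0 ≤ (1 - l) * x ^ 2 := by positivity
        have : 0 ≤ 6 - 7 * l + l ^ 2 := by nlinarith
        nlinarith
      nlinarith
    have h2 : (x - 1) * y ≤ x * (y - 1) := by linarith
    have h3 : (y - 1) ^ 2 ≤ (y - l) ^ 2 := by
      apply pow_le_pow_left₀ <;> linarith
    have hy1 : 0 < y - 1 := by linarith
    have hx0 : 0 < x - 1 := by linarith
    have hy0 : 0 < y := by linarith
    calc l * y ^ 2 * (y - 1) * (y + x) = l * y * (y + x) * (y * (y - 1)) := by ring
      _ ≤ 2 * (x - 1) ^ 2 * (y * (y - 1)) := by gcongr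
      _ = 2 * (x - 1) * (y - 1) * ((x - 1) * y) := by ring
      _ ≤ 2 * (x - 1) * (y - 1) * (x * (y - 1)) := by gcongr
      _ = 2 * x * (x - 1) * (y - 1) ^ 2 := by ring
      _ ≤ 2 * x * (x - 1) * (y - l) ^ 2 := by
          have : 0 < x := by linarith
          gcongr
  · left
    apply h.xi₂_neg_of_le
    obtain ⟨D, hD⟩ : ∃ D, D = y - x := ⟨_, rfl⟩
    rw [← hD]
    have hD14 : 14 ≤ D := by nlinarith
    have k1 : (1 - l) * (D + 1) ≤ 2 * D := by nlinarith
    have k2 : 2 * (4 * x + 6 * D) ≤ x * D := by nlinarith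
    calc (4 * x + 6 * D) * (1 - l) * (D + 1) = (4 * x + 6 * D) * ((1 - l) * (D + 1)) := by ring
      _ ≤ (4 * x + 6 * D) * (2 * D) := by gcongr
      _ = 2 * (4 * x + 6 * D) * D := by ring
      _ ≤ x * D * D := by gcongr
      _ = x * D ^ 2 := by ring

/-- The curvilinear rectangle `x₀ ≤ x ≤ M`, `x + 1 - l ≤ y ≤ 4x/l²` satisfies the sign conditions
of `exists_common_zero`, with `x₀` close to `1` and `M` large. -/
theorem exists_periods_eq_zero {l : ℝ} (hl0 : 0 < l) (hl1 : l < 1) :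
    ∃ x y : ℝ, Admissible l x y ∧ xi₁ l x y = 0 ∧ xi₂ l x y = 0 := by
  have h1l : 0 < 1 - l := by linarith
  obtain ⟨κ, hκ⟩ : ∃ κ, κ = (1 - l) ^ 3 * l ^ 3 / 24 := ⟨_, rfl⟩
  obtain ⟨x₀, hx₀⟩ : ∃ x₀, x₀ = 1 + l * (1 - l ^ 2) / 16 * κ ^ 4 := ⟨_, rfl⟩
  obtain ⟨M, hM⟩ : ∃ M, M = x₀ + 28 / (1 - l) := ⟨_, rfl⟩
  have hx₀1 : 1 < x₀ := by
    have h2 : 0 < 1 - l ^ 2 := by nlinarith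
    have h3 : 0 < κ := by rw [hκ]; positivity
    have : 0 < l * (1 - l ^ 2) / 16 * κ ^ 4 := by positivity
    linarith
  have hM0 : 0 < M - x₀ := by
    have : 0 < 28 / (1 - l) := by positivity
    linarith
  -- clamping to `[0, 1]` extends the parametrisation of the curvilinear rectangle to the plane
  set cl : ℝ → ℝ := fun t => max 0 (min 1 t) with hcl
  have hclc : Continuous cl := by fun_prop
  have hcl0 : ∀ t, 0 ≤ cl t := fun t => le_max_left _ _
  have hcl1 : ∀ t, cl t ≤ 1 := fun t => max_le zero_le_one (min_le_left _ _)
  have hc0 : cl 0 = 0 := by simp [hcl]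
  have hc1 : cl 1 = 1 := by simp [hcl]
  set X : ℝ × ℝ → ℝ := fun p => x₀ + cl p.1 * (M - x₀) with hX
  set Y : ℝ × ℝ → ℝ := fun p =>
    (1 - cl p.2) * (X p + 1 - l) + cl p.2 * (4 * X p / l ^ 2) with hY
  have hXc : Continuous X := by fun_prop
  have hYc : Continuous Y := by fun_prop
  have hX1 : ∀ p, 1 < X p := by
    intro p
    have := mul_nonneg (hcl0 p.1) hM0.le
    simp only [hX]; linarith
  have hYge : ∀ p, X p + 1 - l ≤ Y p := by
    intro p
    have h2 := hX1 p
    have : X p + 1 - l ≤ 4 * X p / l ^ 2 := by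
      rw [le_div_iff₀ (by positivity)]
      have : l ^ 2 ≤ 1 := pow_le_one₀ hl0.le hl1.le
      nlinarith
    have := mul_le_mul_of_nonneg_left this (hcl0 p.2)
    simp only [hY]; linarith
  have hadm : ∀ p, Admissible l (X p) (Y p) := fun p =>
    ⟨hl0, hl1, hX1 p, by linarith [hYge p]⟩
  obtain ⟨p, hp1, hp2⟩ := exists_common_zero (continuous_xi₁ hXc hYc hadm)
    (continuous_xi₂ hXc hYc hadm)
    (by
      intro u _
      have e : Y (u, 0) = X (u, 0) + 1 - l := by simp [hY, hc0]
      have := hadm (u, 0)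
      rw [e] at this ⊢
      exact Admissible.xi₂_pos_of_sub_eq this)
    (by
      intro u _
      exact (hadm (u, 1)).xi₂_neg_of_eq (by simp [hY, hc1]))
    (by
      intro v _
      exact left_edge_sign (hadm (0, v)) hκ (by simp [hX, hc0, hx₀]) (hYge _))
    (by
      intro v _
      exact right_edge_sign (hadm (1, v)) (by simp only [hX, hc1]; linarith))
  exact ⟨X p, Y p, hadm p, hp1, hp2⟩

end PeriodProblem

theorem proposition3p2 (l : ℝ) (hl0 : 0 < l) (hl1 : l < 1) :
    ∃ l₁ l₂ : ℝ, 1 < l₁ ∧ l₁ < l₂ ∧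
      IntervalIntegrable (PeriodProblem.phi₁ l l₁ l₂) MeasureTheory.volume 1 l₁ ∧
      PeriodProblem.xi₁ l l₁ l₂ = 0 ∧
      IntervalIntegrable (PeriodProblem.phi₂ l l₁ l₂) MeasureTheory.volume l₁ l₂ ∧
      PeriodProblem.xi₂ l l₁ l₂ = 0 := by
  obtain ⟨x, y, h, h1, h2⟩ := PeriodProblem.exists_periods_eq_zero hl0 hl1
  exact ⟨x, y, h.one_lt, h.lt, h.xi₁_eq.1, h1, h.xi₂_eq.1, h2⟩
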